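/- Write $\mathbf x^{\perp}=(-x_2,x_1)$ for $\mathbf x=(x_1,x_2)\in\mathbb R^2$. For a bounded open set $U\subset\mathbb R^2$ with area $|U|$, a coupling constant $G>0$ and a mass $M>0$, let $$\mathcal E^{\rm GP}_U[u]=\frac12\int_U\Big(\big|(-\mathrm i\nabla-\mathbf x^{\perp})u\big|^2+G|u|^4\Big)\,d\mathbf x ,$$ and define the Neumann and Dirichlet energies $$E^{\rm GP}(U,M)=\inf\Big\{\mathcal E^{\rm GP}_U[u]:u\in H^1(U;\mathbb C),\ \int_U|u|^2=M\Big\},\qquad E^{\rm GP}_0(U,M)=\inf\Big\{\mathcal E^{\rm GP}_U[u]:u\in H^1_0(U;\mathbb C),\ \int_U|u|^2=M\Big\}.$$ **Theorem 2.1 (Thermodynamic limit for the homogeneous gas).** Let $G>0$ and $\varrho>0$ be fixed. There is a finite number $e^{\rm GP}(\varrho)\ge 0$, depending only on $G$ and $\varrho$, such that for every bounded simply connected domain $\mathcal D\subset\mathbb R^2$ (non-empty, open, connected) with Lipschitz boundary, both of the following limits exist and $$\lim_{L\to\infty}\frac{E^{\rm GP}(L\mathcal D,\varrho|L\mathcal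 D|)}{|L\mathcal D|}=\lim_{L\to\infty}\frac{E^{\rm GP}_0(L\mathcal D,\varrho|L\mathcal D|)}{|L\mathcal D|}=e^{\rm GP}(\varrho).$$ Here $L\to\infty$ through the real numbers and $L\mathcal D=\{L\mathbf x:\mathbf x\in\mathcal D\}$. -/

import Mathlib

open MeasureTheory Filter Topology
open scoped ENNReal NNReal Pointwise ContDiff

/-- The Euclidean plane `ℝ²`. -/
abbrev Plane : Type := EuclideanSpace ℝ (Fin 2)

/-- The rotated vector `x^⊥ = (-x₂, x₁)`. -/
def perp (x : Plane) : Plane := !₂[-x 1, x 0]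

/-- The `j`-th partial derivative of a differentiable function on the plane. -/
noncomputable def partialDeriv {F : Type*} [NormedAddCommGroup F] [NormedSpace ℝ F]
    (j : Fin 2) (f : Plane → F) (x : Plane) : F :=
  fderiv ℝ f x (EuclideanSpace.single j 1)

/-- `φ ∈ C_c^∞(U; F)`: smooth, with compact support contained in `U`. -/
structure IsTestFunction {F : Type*} [NormedAddCommGroup F] [NormedSpace ℝ F]
    (U : Set Plane) (φ : Plane → F) : Prop where
  smooth : ContDiff ℝ ∞ φ
  compact : HasCompactSupport φ
  support_subset : tsupport φ ⊆ U

/-- `u ∈ H¹(U)` with weak gradient `∇u = (g 0, g 1)`: the functions `u`, `g 0`, `g 1` are in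
`L²(U; ℂ)` and `∫_U u ∂_j φ = -∫_U g_j φ` for all test functions `φ ∈ C_c^∞(U)`. The weak gradient
is determined by `u` up to a null set. -/
structure MemH1 (U : Set Plane) (u : Plane → ℂ) (g : Fin 2 → Plane → ℂ) : Prop where
  memLp : MemLp u 2 (volume.restrict U)
  memLp_grad : ∀ j, MemLp (g j) 2 (volume.restrict U)
  weak_grad : ∀ φ : Plane → ℝ, IsTestFunction U φ → ∀ j,
    ∫ x in U, ((partialDeriv j φ x : ℝ) : ℂ) * u x = -∫ x in U, (φ x : ℂ) * g j x

/-- `u ∈ H¹₀(U)` with weak gradient `g`: `u` belongs to the closure of `C_c^∞(U; ℂ)` in `H¹(U)`. -/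
structure MemH10 (U : Set Plane) (u : Plane → ℂ) (g : Fin 2 → Plane → ℂ) : Prop
    extends MemH1 U u g where
  approx : ∃ φ : ℕ → Plane → ℂ, (∀ n, IsTestFunction U (φ n)) ∧
    Tendsto (fun n => eLpNorm (u - φ n) 2 (volume.restrict U)) atTop (𝓝 0) ∧
    ∀ j, Tendsto (fun n => eLpNorm (g j - partialDeriv j (φ n)) 2 (volume.restrict U))
      atTop (𝓝 0)

/-- The magnetic Gross-Pitaevskii functional
`½ ∫_U |(-i∇ - x^⊥) u|² + G |u|⁴ ∈ [0, ∞]`, where `g = ∇u`. -/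
noncomputable def gpFunctional (G : ℝ) (U : Set Plane) (u : Plane → ℂ) (g : Fin 2 → Plane → ℂ) :
    ℝ≥0∞ :=
  ∫⁻ x in U, ENNReal.ofReal
    ((1 / 2) * ((∑ j, ‖-Complex.I * g j x - (perp x j : ℂ) * u x‖ ^ 2) + G * ‖u x‖ ^ 4))

/-- The mass `∫_U |u|²`. -/
noncomputable def mass (U : Set Plane) (u : Plane → ℂ) : ℝ≥0∞ :=
  ∫⁻ x in U, ENNReal.ofReal (‖u x‖ ^ 2)

/-- The Neumann energy: infimum of the functional over `u ∈ H¹(U)` of mass `M`. -/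
noncomputable def neumannEnergy (G : ℝ) (U : Set Plane) (M : ℝ≥0∞) : ℝ≥0∞ :=
  sInf {E | ∃ u g, MemH1 U u g ∧ mass U u = M ∧ E = gpFunctional G U u g}

/-- The Dirichlet energy: infimum of the functional over `u ∈ H¹₀(U)` of mass `M`. -/
noncomputable def dirichletEnergy (G : ℝ) (U : Set Plane) (M : ℝ≥0∞) : ℝ≥0∞ :=
  sInf {E | ∃ u g, MemH10 U u g ∧ mass U u = M ∧ E = gpFunctional G U u g}

/-- `D` has Lipschitz boundary: near each boundary point `p`, in suitable orthonormal
coordinates centred at `p`, the set `D` is the strict epigraph of a Lipschitz function. -/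
def HasLipschitzBoundary (D : Set Plane) : Prop :=
  ∀ p ∈ frontier D, ∃ (b : OrthonormalBasis (Fin 2) ℝ Plane) (r : ℝ) (K : ℝ≥0) (γ : ℝ → ℝ),
    0 < r ∧ LipschitzWith K γ ∧
      ∀ x ∈ Metric.ball p r, x ∈ D ↔ γ (inner ℝ (b 0) (x - p)) < inner ℝ (b 1) (x - p)

/-!
Put `E(U, M)` for the Dirichlet energy. Trial states supported in disjoint sets can be added, so
`E` is subadditive over disjoint sets, and by magnetic translations the energy of a square does not
depend on its position. Hence packing small squares into any dilated set `L • D` bounds the upper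
limit of its Dirichlet energy density by the infimum over squares of that density, `gpDensity`.

For the matching lower bound on the Neumann energy, cut a trial state on `L • D` off near the
boundary. The cutoff lives on the scale `L`, so its gradient costs `O(L⁻²)` per unit mass, and the
quartic term keeps the mass from concentrating in the thin boundary region. The resulting Dirichlet
state is completed to one on a dilated square `L • W`, with `D ⊆ W`, by packing `L • (W \ D)` with
small squares of almost optimal density. The energy density on `L • W` is at least `gpDensity`, and
subtracting the share of `W \ D` leaves the bound on `D`.
-/

open scoped Convolution

/-! ### Limits in `Lᵖ` -/

section Lp

variable {α ι F 𝔸 : Type*} [MeasurableSpace α] {μ : Measure α} [NormedAddCommGroup F]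
  [NormedRing 𝔸] {l : Filter ι} {p q r : ℝ≥0∞}

theorem tendsto_eLpNorm_add_zero (hp : 1 ≤ p) {f g : ι → α → F}
    (hf : ∀ n, AEStronglyMeasurable (f n) μ) (hg : ∀ n, AEStronglyMeasurable (g n) μ)
    (hf0 : Tendsto (fun n => eLpNorm (f n) p μ) l (𝓝 0))
    (hg0 : Tendsto (fun n => eLpNorm (g n) p μ) l (𝓝 0)) :
    Tendsto (fun n => eLpNorm (f n + g n) p μ) l (𝓝 0) :=
  tendsto_of_tendsto_of_tendsto_of_le_of_le tendsto_const_nhds (by simpa using hf0.add hg0)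
    (fun _ => zero_le) fun n => eLpNorm_add_le (hf n) (hg n) hp

theorem tendsto_eLpNorm_mul_zero [p.HolderTriple q r] {a : α → 𝔸} (ha : MemLp a p μ)
    {f : ι → α → 𝔸} (hf : ∀ n, AEStronglyMeasurable (f n) μ)
    (hf0 : Tendsto (fun n => eLpNorm (f n) q μ) l (𝓝 0)) :
    Tendsto (fun n => eLpNorm (a * f n) r μ) l (𝓝 0) := by
  have h : Tendsto (fun n => eLpNorm a p μ * eLpNorm (f n) q μ) l (𝓝 0) := by
    simpa using ENNReal.Tendsto.const_mul hf0 (Or.inr ha.2.ne)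
  have h' : ∀ n, eLpNorm (a • f n) r μ ≤ eLpNorm a p μ * eLpNorm (f n) q μ := fun n =>
    eLpNorm_smul_le_mul_eLpNorm (hf n) ha.1
  exact tendsto_of_tendsto_of_tendsto_of_le_of_le tendsto_const_nhds h (fun _ => zero_le) h'

theorem tendsto_integral_mul_of_tendsto_eLpNorm {𝕜 : Type*} [RCLike 𝕜] [p.HolderConjugate q]
    {a f : α → 𝕜} {f' : ι → α → 𝕜} (ha : MemLp a p μ) (hf : MemLp f q μ)
    (hf' : ∀ n, MemLp (f' n) q μ) (h : Tendsto (fun n => eLpNorm (f - f' n) q μ) l (𝓝 0)) :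
    Tendsto (fun n => ∫ x, a x * f' n x ∂μ) l (𝓝 (∫ x, a x * f x ∂μ)) := by
  refine tendsto_integral_of_L1' _ (hf.mul (r := 1) ha).1
    (Eventually.of_forall fun n => memLp_one_iff_integrable.1 ((hf' n).mul' ha)) ?_
  refine (tendsto_eLpNorm_mul_zero (p := p) (q := q) (r := 1) ha
    (fun n => (hf.sub (hf' n)).1) h).congr fun n => ?_
  rw [mul_sub, eLpNorm_sub_comm]
  rfl

end Lp

/-! ### Test functions -/

section PartialDeriv

variable {F : Type*} [NormedAddCommGroup F] [NormedSpace ℝ F]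

theorem partialDeriv_add {φ ψ : Plane → F} (hφ : Differentiable ℝ φ) (hψ : Differentiable ℝ ψ)
    (j : Fin 2) : partialDeriv j (φ + ψ) = partialDeriv j φ + partialDeriv j ψ := by
  ext x
  simp [partialDeriv, fderiv_add (hφ x) (hψ x)]

theorem partialDeriv_mul {𝔸 : Type*} [NormedCommRing 𝔸] [NormedAlgebra ℝ 𝔸] {φ ψ : Plane → 𝔸}
    (hφ : Differentiable ℝ φ) (hψ : Differentiable ℝ ψ) (j : Fin 2) :
    partialDeriv j (φ * ψ) = φ * partialDeriv j ψ + partialDeriv j φ * ψ := by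
  ext x
  simp [partialDeriv, fderiv_mul (hφ x) (hψ x), mul_comm]

theorem partialDeriv_comp_sub (φ : Plane → F) (a : Plane) (j : Fin 2) :
    partialDeriv j (fun x => φ (x - a)) = fun x => partialDeriv j φ (x - a) := by
  ext x
  simp [partialDeriv, fderiv_comp_sub]

theorem partialDeriv_comp_const_sub {φ : Plane → F} (hφ : Differentiable ℝ φ) (a : Plane)
    (j : Fin 2) : partialDeriv j (fun x => φ (a - x)) = fun x => -partialDeriv j φ (a - x) := by
  ext x
  have h : HasFDerivAt (fun x => φ (a - x))
      ((fderiv ℝ φ (a - x)).comp (-ContinuousLinearMap.id ℝ Plane)) x :=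
    (hφ (a - x)).hasFDerivAt.comp x ((hasFDerivAt_id x).const_sub a)
  simp [partialDeriv, h.fderiv]

theorem continuous_partialDeriv {φ : Plane → F} (hφ : ContDiff ℝ ∞ φ) (j : Fin 2) :
    Continuous (partialDeriv j φ) :=
  (hφ.continuous_fderiv (by simp)).clm_apply continuous_const

end PartialDeriv

namespace IsTestFunction

variable {F : Type*} [NormedAddCommGroup F] [NormedSpace ℝ F] {U V : Set Plane} {φ ψ : Plane → F}

theorem mono (h : IsTestFunction U φ) (hUV : U ⊆ V) : IsTestFunction V φ :=
  ⟨h.smooth, h.compact, h.support_subset.trans hUV⟩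

theorem add (h : IsTestFunction U φ) (h' : IsTestFunction U ψ) : IsTestFunction U (φ + ψ) :=
  ⟨h.smooth.add h'.smooth, h.compact.add h'.compact,
    (tsupport_add φ ψ).trans (Set.union_subset h.support_subset h'.support_subset)⟩

theorem mul_left {𝔸 : Type*} [NormedRing 𝔸] [NormedAlgebra ℝ 𝔸] {φ a : Plane → 𝔸}
    (h : IsTestFunction U φ) (ha : ContDiff ℝ ∞ a) : IsTestFunction U (a * φ) :=
  ⟨ha.mul h.smooth, h.compact.mul_left, tsupport_mul_subset_right.trans h.support_subset⟩

theorem comp_homeomorph (h : IsTestFunction U φ) (e : Plane ≃ₜ Plane) (he : ContDiff ℝ ∞ e) :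
    IsTestFunction (e ⁻¹' U) (φ ∘ e) :=
  ⟨h.smooth.comp he, h.compact.comp_homeomorph e,
    (tsupport_comp_eq_preimage φ e).subset.trans (Set.preimage_mono h.support_subset)⟩

theorem eq_zero (h : IsTestFunction U φ) {x : Plane} (hx : x ∉ U) : φ x = 0 :=
  image_eq_zero_of_notMem_tsupport fun hx' => hx (h.support_subset hx')

theorem partialDeriv_eq_zero (h : IsTestFunction U φ) (j : Fin 2) {x : Plane} (hx : x ∉ U) :
    partialDeriv j φ x = 0 := by
  have : fderiv ℝ φ x = 0 := by
    by_contra hne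
    exact hx (h.support_subset (support_fderiv_subset ℝ hne))
  simp [partialDeriv, this]

theorem continuous (h : IsTestFunction U φ) : Continuous φ := h.smooth.continuous

theorem differentiable (h : IsTestFunction U φ) : Differentiable ℝ φ :=
  h.smooth.differentiable (by simp)

theorem continuous_partialDeriv (h : IsTestFunction U φ) (j : Fin 2) :
    Continuous (partialDeriv j φ) :=
  _root_.continuous_partialDeriv h.smooth j

theorem hasCompactSupport_partialDeriv (h : IsTestFunction U φ) (j : Fin 2) :
    HasCompactSupport (partialDeriv j φ) :=
  h.compact.fderiv_apply (𝕜 := ℝ) _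

theorem memLp (h : IsTestFunction U φ) (p : ℝ≥0∞) (μ : Measure Plane)
    [IsFiniteMeasureOnCompacts μ] : MemLp φ p μ :=
  h.continuous.memLp_of_hasCompactSupport h.compact

theorem memLp_partialDeriv (h : IsTestFunction U φ) (j : Fin 2) (p : ℝ≥0∞) (μ : Measure Plane)
    [IsFiniteMeasureOnCompacts μ] : MemLp (partialDeriv j φ) p μ :=
  (h.continuous_partialDeriv j).memLp_of_hasCompactSupport (h.hasCompactSupport_partialDeriv j)

theorem integral_partialDeriv_mul {φ : Plane → ℝ} {ψ : Plane → ℂ} (hφ : IsTestFunction U φ)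
    (hψ : IsTestFunction V ψ) (j : Fin 2) :
    ∫ x, ((partialDeriv j φ x : ℝ) : ℂ) * ψ x = -∫ x, (φ x : ℂ) * partialDeriv j ψ x := by
  have hI : ∀ {a : Plane → ℝ} {b : Plane → ℂ}, Continuous a → HasCompactSupport a →
      Continuous b → Integrable (fun x => a x • b x) := fun ha ha' hb =>
    (ha.smul hb).integrable_of_hasCompactSupport ha'.smul_right
  have := integral_smul_fderiv_eq_neg_fderiv_smul_of_integrable (μ := (volume : Measure Plane))
    (f := φ) (g := ψ) (v := EuclideanSpace.single j 1)
    (hI (hφ.continuous_partialDeriv j) (hφ.hasCompactSupport_partialDeriv j) hψ.continuous)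
    (hI hφ.continuous hφ.compact (hψ.continuous_partialDeriv j))
    (hI hφ.continuous hφ.compact hψ.continuous)
    (fun x _ => hφ.differentiable x) (fun x _ => hψ.differentiable x)
  simp only [Complex.real_smul] at this
  simp only [partialDeriv]
  rw [this, neg_neg]

end IsTestFunction

/-! ### Operations on `H¹₀` -/

namespace MemH10

variable {U V : Set Plane} {u v : Plane → ℂ} {g h : Fin 2 → Plane → ℂ}

theorem of_tendsto (hu : MemLp u 2 (volume.restrict U))
    (hg : ∀ j, MemLp (g j) 2 (volume.restrict U))
    {φ : ℕ → Plane → ℂ} (hφ : ∀ n, IsTestFunction U (φ n))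
    (h0 : Tendsto (fun n => eLpNorm (u - φ n) 2 (volume.restrict U)) atTop (𝓝 0))
    (h1 : ∀ j, Tendsto (fun n => eLpNorm (g j - partialDeriv j (φ n)) 2 (volume.restrict U))
      atTop (𝓝 0)) : MemH10 U u g where
  memLp := hu
  memLp_grad := hg
  weak_grad ψ hψ j := by
    have hA := tendsto_integral_mul_of_tendsto_eLpNorm
      (hψ.memLp_partialDeriv j 2 (volume.restrict U)).ofReal hu (fun n => (hφ n).memLp 2 _) h0
    have hB := tendsto_integral_mul_of_tendsto_eLpNorm
      (hψ.memLp 2 (volume.restrict U)).ofReal (hg j)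
      (fun n => (hφ n).memLp_partialDeriv j 2 _) (h1 j)
    refine tendsto_nhds_unique hA (hB.neg.congr fun n => ?_)
    rw [setIntegral_eq_integral_of_forall_compl_eq_zero
        (fun x hx => by rw [(hφ n).partialDeriv_eq_zero j hx, mul_zero]),
      setIntegral_eq_integral_of_forall_compl_eq_zero
        (fun x hx => by rw [(hφ n).eq_zero hx, mul_zero])]
    exact (hψ.integral_partialDeriv_mul (hφ n) j).symm
  approx := ⟨φ, hφ, h0, h1⟩

theorem of_forall_exists_eLpNorm_le (hu : MemLp u 2 (volume.restrict U))
    (hg : ∀ j, MemLp (g j) 2 (volume.restrict U))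
    (h : ∀ ε : ℝ≥0∞, 0 < ε → ∃ φ, IsTestFunction U φ ∧ eLpNorm (u - φ) 2 (volume.restrict U) ≤ ε ∧
      ∀ j, eLpNorm (g j - partialDeriv j φ) 2 (volume.restrict U) ≤ ε) : MemH10 U u g := by
  choose φ hφ hφ0 hφ1 using fun n : ℕ => h ((n : ℝ≥0∞)⁻¹) (by simp)
  refine .of_tendsto hu hg hφ ?_ fun j => ?_
  · exact tendsto_of_tendsto_of_tendsto_of_le_of_le tendsto_const_nhds
      ENNReal.tendsto_inv_nat_nhds_zero (fun _ => zero_le) hφ0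
  · exact tendsto_of_tendsto_of_tendsto_of_le_of_le tendsto_const_nhds
      ENNReal.tendsto_inv_nat_nhds_zero (fun _ => zero_le) (hφ1 · j)

theorem of_isTestFunction {φ : Plane → ℂ} (h : IsTestFunction U φ) :
    MemH10 U φ (fun j => partialDeriv j φ) :=
  .of_tendsto (h.memLp 2 _) (fun j => h.memLp_partialDeriv j 2 _) (φ := fun _ => φ)
    (fun _ => h) (by simp) (by simp)

theorem add (hu : MemH10 U u g) (hv : MemH10 U v h) : MemH10 U (u + v) (fun j => g j + h j) := by
  obtain ⟨φ, hφ, hφ0, hφ1⟩ := hu.approx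
  obtain ⟨ψ, hψ, hψ0, hψ1⟩ := hv.approx
  refine .of_tendsto (hu.memLp.add hv.memLp) (fun j => (hu.memLp_grad j).add (hv.memLp_grad j))
    (fun n => (hφ n).add (hψ n)) ?_ fun j => ?_
  · simp only [add_sub_add_comm]
    exact tendsto_eLpNorm_add_zero (by norm_num) (fun n => (hu.memLp.sub ((hφ n).memLp 2 _)).1)
      (fun n => (hv.memLp.sub ((hψ n).memLp 2 _)).1) hφ0 hψ0
  · simp only [partialDeriv_add (hφ _).differentiable (hψ _).differentiable, add_sub_add_comm]
    exact tendsto_eLpNorm_add_zero (by norm_num)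
      (fun n => ((hu.memLp_grad j).sub ((hφ n).memLp_partialDeriv j 2 _)).1)
      (fun n => ((hv.memLp_grad j).sub ((hψ n).memLp_partialDeriv j 2 _)).1) (hφ1 j) (hψ1 j)

theorem indicator (hU : MeasurableSet U) (hUV : U ⊆ V) (hu : MemH10 U u g) :
    MemH10 V (U.indicator u) (fun j => U.indicator (g j)) := by
  obtain ⟨φ, hφ, hφ0, hφ1⟩ := hu.approx
  have hr : (volume.restrict V).restrict U = volume.restrict U := by
    rw [Measure.restrict_restrict hU, Set.inter_eq_left.2 hUV]
  have hm : ∀ {f : Plane → ℂ}, MemLp f 2 (volume.restrict U) →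
      MemLp (U.indicator f) 2 (volume.restrict V) := by
    intro f hf
    rwa [memLp_indicator_iff_restrict hU, hr]
  have hk : ∀ (f k : Plane → ℂ), (∀ x ∉ U, k x = 0) →
      eLpNorm (U.indicator f - k) 2 (volume.restrict V) =
        eLpNorm (f - k) 2 (volume.restrict U) := by
    intro f k h
    rw [← hr, ← eLpNorm_indicator_eq_eLpNorm_restrict hU]
    congr 1
    ext x
    by_cases hx : x ∈ U <;> simp [hx, h]
  refine .of_tendsto (hm hu.memLp) (fun j => hm (hu.memLp_grad j)) (fun n => (hφ n).mono hUV)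
    ?_ fun j => ?_
  · simpa only [hk _ _ (fun _ hx => (hφ _).eq_zero hx)] using hφ0
  · simpa only [hk _ _ (fun _ hx => (hφ _).partialDeriv_eq_zero j hx)] using hφ1 j

theorem mul_left (hu : MemH10 U u g) {a : Plane → ℂ} (ha : ContDiff ℝ ∞ a)
    (ha' : MemLp a ∞ (volume.restrict U))
    (hda : ∀ j, MemLp (partialDeriv j a) ∞ (volume.restrict U)) :
    MemH10 U (a * u) (fun j => a * g j + partialDeriv j a * u) := by
  obtain ⟨φ, hφ, hφ0, hφ1⟩ := hu.approx
  have hu' := fun n => hu.memLp.sub ((hφ n).memLp 2 (volume.restrict U))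
  have hg' := fun j n => (hu.memLp_grad j).sub ((hφ n).memLp_partialDeriv j 2 (volume.restrict U))
  refine .of_tendsto (φ := fun n => a * φ n) (hu.memLp.mul ha')
    (fun j => ((hu.memLp_grad j).mul ha').add (hu.memLp.mul (hda j)))
    (fun n => (hφ n).mul_left ha) ?_ fun j => ?_
  · simp only [← mul_sub]
    exact tendsto_eLpNorm_mul_zero ha' (fun n => (hu' n).1) hφ0
  · simp only [partialDeriv_mul (ha.differentiable (by simp)) (hφ _).differentiable,
      add_sub_add_comm, ← mul_sub]
    exact tendsto_eLpNorm_add_zero (by norm_num) (fun n => ((hg' j n).mul (r := 2) ha').1)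
      (fun n => ((hu' n).mul (r := 2) (hda j)).1)
      (tendsto_eLpNorm_mul_zero ha' (fun n => (hg' j n).1) (hφ1 j))
      (tendsto_eLpNorm_mul_zero (hda j) (fun n => (hu' n).1) hφ0)

theorem const_mul (hu : MemH10 U u g) (c : ℂ) :
    MemH10 U (fun x => c * u x) (fun j x => c * g j x) := by
  have h0 : ∀ j, partialDeriv j (fun _ : Plane => c) = 0 := fun j => by
    ext x; simp [partialDeriv]
  have := hu.mul_left (a := fun _ => c) contDiff_const (memLp_top_const c)
    (by simp [h0])
  simpa [h0, Pi.mul_def] using this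

theorem comp_sub (hU : MeasurableSet U) (hu : MemH10 U u g) (a : Plane) :
    MemH10 ((fun x => x - a) ⁻¹' U) (fun x => u (x - a)) (fun j x => g j (x - a)) := by
  obtain ⟨φ, hφ, hφ0, hφ1⟩ := hu.approx
  have hmp := (measurePreserving_sub_right (volume : Measure Plane) a).restrict_preimage hU
  have he : ∀ {f k : Plane → ℂ}, MemLp f 2 (volume.restrict U) → MemLp k 2 (volume.restrict U) →
      eLpNorm ((fun x => f (x - a)) - fun x => k (x - a)) 2
        (volume.restrict ((fun x => x - a) ⁻¹' U)) = eLpNorm (f - k) 2 (volume.restrict U) :=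
    fun hf hk => eLpNorm_comp_measurePreserving (g := _ - _) (hf.sub hk).1 hmp
  refine .of_tendsto (φ := fun n x => φ n (x - a)) (hu.memLp.comp_measurePreserving hmp)
    (fun j => (hu.memLp_grad j).comp_measurePreserving hmp)
    (fun n => (hφ n).comp_homeomorph (Homeomorph.subRight a) (contDiff_id.sub contDiff_const))
    ?_ fun j => ?_
  · simpa only [he hu.memLp ((hφ _).memLp 2 _)] using hφ0
  · simpa only [partialDeriv_comp_sub, he (hu.memLp_grad j) ((hφ _).memLp_partialDeriv j 2 _)]
      using hφ1 j

end MemH10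

/-! ### Mollification -/

theorem enorm_integral_rpow_le_lintegral {β F : Type*} [MeasurableSpace β] [NormedAddCommGroup F]
    [NormedSpace ℝ F] {ν : Measure β} [IsProbabilityMeasure ν] {p : ℝ≥0} (hp : 1 ≤ p) {f : β → F}
    (hf : AEStronglyMeasurable f ν) :
    ‖∫ t, f t ∂ν‖ₑ ^ (p : ℝ) ≤ ∫⁻ t, ‖f t‖ₑ ^ (p : ℝ) ∂ν := by
  have h := eLpNorm_le_eLpNorm_of_exponent_le (p := 1) (q := p) (by exact_mod_cast hp) hf
  rw [eLpNorm_one_eq_lintegral_enorm] at h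
  calc ‖∫ t, f t ∂ν‖ₑ ^ (p : ℝ) ≤ eLpNorm f p ν ^ (p : ℝ) := by
        gcongr
        exact (enorm_integral_le_lintegral_enorm _).trans h
    _ = ∫⁻ t, ‖f t‖ₑ ^ (p : ℝ) ∂ν :=
        eLpNorm_nnreal_pow_eq_lintegral (zero_lt_one.trans_le hp).ne'

theorem eLpNorm_integral_le_of_ae_le {α β F : Type*} [MeasurableSpace α] [MeasurableSpace β]
    [NormedAddCommGroup F] [NormedSpace ℝ F] {μ : Measure α} [SFinite μ] {ν : Measure β}
    [IsProbabilityMeasure ν] {p : ℝ≥0} (hp : 1 ≤ p) {f : α → β → F}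
    (hf : AEStronglyMeasurable (Function.uncurry f) (μ.prod ν)) {ε : ℝ≥0∞}
    (hε : ∀ᵐ t ∂ν, eLpNorm (f · t) p μ ≤ ε) :
    eLpNorm (fun x => ∫ t, f x t ∂ν) p μ ≤ ε := by
  have hp0 : 0 < p := zero_lt_one.trans_le hp
  rw [← ENNReal.rpow_le_rpow_iff (NNReal.coe_pos.2 hp0), eLpNorm_nnreal_pow_eq_lintegral hp0.ne']
  calc ∫⁻ x, ‖∫ t, f x t ∂ν‖ₑ ^ (p : ℝ) ∂μ
      ≤ ∫⁻ x, ∫⁻ t, ‖f x t‖ₑ ^ (p : ℝ) ∂ν ∂μ := by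
        refine lintegral_mono_ae ?_
        filter_upwards [hf.prodMk_left] with x hx
        exact enorm_integral_rpow_le_lintegral hp hx
    _ = ∫⁻ t, ∫⁻ x, ‖f x t‖ₑ ^ (p : ℝ) ∂μ ∂ν := lintegral_lintegral_swap (hf.enorm.pow_const _)
    _ ≤ ∫⁻ _, ε ^ (p : ℝ) ∂ν := by
        refine lintegral_mono_ae ?_
        filter_upwards [hε] with t ht
        rw [← eLpNorm_nnreal_pow_eq_lintegral hp0.ne']
        gcongr
    _ = ε ^ (p : ℝ) := by simp

section Convolution

variable {E F : Type*} [NormedAddCommGroup E] [NormedSpace ℝ E] [FiniteDimensional ℝ E]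
  [MeasurableSpace E] [BorelSpace E] {μ : Measure E} [μ.IsAddHaarMeasure]
  [NormedAddCommGroup F] {f : E → F}

theorem tendsto_eLpNorm_sub_comp_sub {p : ℝ≥0∞} [Fact (1 ≤ p)] (hp : p ≠ ⊤) (hf : MemLp f p μ) :
    Tendsto (fun t => eLpNorm (fun x => f x - f (x - t)) p μ) (𝓝 (0 : E)) (𝓝 0) := by
  have hmp : ∀ t : E, MeasurePreserving (fun x => x - t) μ μ := measurePreserving_sub_right μ
  let σ : C(E, C(E, E)) := (ContinuousMap.mk (fun a : E × E => a.2 - a.1) (by fun_prop)).curry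
  have h := (tendsto_const_nhds (x := hf.toLp f) (f := 𝓝 (0 : E))).compMeasurePreservingLp
    (σ.continuous.tendsto 0) (fun t => hmp t) (hmp 0) hp
  rw [tendsto_iff_edist_tendsto_0] at h
  refine h.congr fun t => ?_
  rw [edist_comm, Lp.edist_def]
  refine eLpNorm_congr_ae ?_
  have h1 : ∀ t, Lp.compMeasurePreserving (σ t) (hmp t) (hf.toLp f) =ᵐ[μ] fun x => f (x - t) :=
    fun t => (Lp.coeFn_compMeasurePreserving _ _).trans
      ((hmp t).quasiMeasurePreserving.ae_eq_comp hf.coeFn_toLp)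
  filter_upwards [h1 t, h1 0] with x hx hx0
  simp [hx, hx0]

theorem isProbabilityMeasure_withDensity_ofReal {α : Type*} [MeasurableSpace α] {μ : Measure α}
    {K : α → ℝ} (hK : Integrable K μ) (hK0 : 0 ≤ K) (hK1 : ∫ x, K x ∂μ = 1) :
    IsProbabilityMeasure (μ.withDensity fun x => ENNReal.ofReal (K x)) := by
  constructor
  rw [withDensity_apply _ MeasurableSet.univ, Measure.restrict_univ,
    ← ofReal_integral_eq_lintegral_ofReal hK (Eventually.of_forall hK0), hK1, ENNReal.ofReal_one]

variable [NormedSpace ℝ F] [CompleteSpace F]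

theorem sub_convolution_eq_integral_withDensity (hf : LocallyIntegrable f μ) {K : E → ℝ}
    (hK : Continuous K) (hKc : HasCompactSupport K) (hK0 : 0 ≤ K) (hK1 : ∫ x, K x ∂μ = 1) (x : E) :
    f x - (K ⋆[ContinuousLinearMap.lsmul ℝ ℝ, μ] f) x =
      ∫ t, (f x - f (x - t)) ∂(μ.withDensity fun t => ENNReal.ofReal (K t)) := by
  have hKi : Integrable K μ := hK.integrable_of_hasCompactSupport hKc
  have hInt : Integrable (fun t => K t • f (x - t)) μ :=
    hKc.convolutionExists_left (ContinuousLinearMap.lsmul ℝ ℝ) hK hf x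
  rw [integral_withDensity_eq_integral_toReal_smul hK.measurable.ennreal_ofReal (by simp)]
  simp only [ENNReal.toReal_ofReal (hK0 _), smul_sub]
  rw [integral_sub (hKi.smul_const _) hInt, integral_smul_const, hK1, one_smul]
  rfl

theorem eLpNorm_sub_convolution_le {p : ℝ≥0} (hp : 1 ≤ p) (hf : MemLp f p μ)
    {K : E → ℝ} (hK : Continuous K) (hKc : HasCompactSupport K) (hK0 : 0 ≤ K)
    (hK1 : ∫ x, K x ∂μ = 1) {ε : ℝ≥0∞}
    (hε : ∀ t ∈ Function.support K, eLpNorm (fun x => f x - f (x - t)) p μ ≤ ε) :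
    eLpNorm (f - K ⋆[ContinuousLinearMap.lsmul ℝ ℝ, μ] f) p μ ≤ ε := by
  have hfl : LocallyIntegrable f μ := hf.locallyIntegrable (by exact_mod_cast hp)
  have hprob := isProbabilityMeasure_withDensity_ofReal
    (hK.integrable_of_hasCompactSupport (μ := μ) hKc) hK0 hK1
  have hm : AEStronglyMeasurable (Function.uncurry fun x t => f x - f (x - t))
      (μ.prod (μ.withDensity fun t => ENNReal.ofReal (K t))) :=
    hf.1.comp_fst.sub (hf.1.comp_quasiMeasurePreserving
      (quasiMeasurePreserving_sub_of_right_invariant μ _))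
  have heq : f - K ⋆[ContinuousLinearMap.lsmul ℝ ℝ, μ] f =
      fun x => ∫ t, (f x - f (x - t)) ∂(μ.withDensity fun t => ENNReal.ofReal (K t)) :=
    funext (sub_convolution_eq_integral_withDensity hfl hK hKc hK0 hK1)
  rw [heq]
  refine eLpNorm_integral_le_of_ae_le hp hm ?_
  rw [ae_withDensity_iff hK.measurable.ennreal_ofReal]
  exact Eventually.of_forall fun t ht => hε t fun h => ht (by simp [h])

end Convolution

theorem exists_isTestFunction_closedBall_integral_eq_one {δ : ℝ} (hδ : 0 < δ) :
    ∃ K : Plane → ℝ, IsTestFunction (Metric.closedBall 0 δ) K ∧ 0 ≤ K ∧ ∫ x, K x = 1 := by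
  let b : ContDiffBump (0 : Plane) := ⟨δ / 2, δ, half_pos hδ, half_lt_self hδ⟩
  exact ⟨b.normed volume, ⟨b.contDiff_normed, b.hasCompactSupport_normed,
    b.tsupport_normed_eq.subset⟩, b.nonneg_normed, b.integral_normed⟩

theorem partialDeriv_convolution {V : Set Plane} {K : Plane → ℝ} (hK : IsTestFunction V K)
    {v h : Plane → ℂ} (hv : LocallyIntegrable v volume) {j : Fin 2}
    (hw : ∀ ψ : Plane → ℝ, IsTestFunction Set.univ ψ →
      ∫ x, ((partialDeriv j ψ x : ℝ) : ℂ) * v x = -∫ x, (ψ x : ℂ) * h x) :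
    partialDeriv j (K ⋆[ContinuousLinearMap.lsmul ℝ ℝ, volume] v) =
      K ⋆[ContinuousLinearMap.lsmul ℝ ℝ, volume] h := by
  ext x
  have hψ : IsTestFunction Set.univ (fun t => K (x - t)) :=
    (hK.comp_homeomorph (Homeomorph.subLeft x) (contDiff_const.sub contDiff_id)).mono
      (Set.subset_univ _)
  have hwx := hw _ hψ
  simp only [partialDeriv_comp_const_sub hK.differentiable, Complex.ofReal_neg, neg_mul,
    integral_neg, neg_inj] at hwx
  rw [← convolution_flip, partialDeriv,
    (hK.compact.hasFDerivAt_convolution_right _ hv (hK.smooth.of_le (by simp)) x).fderiv,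
    convolution_precompR_apply _ hv (hK.compact.fderiv ℝ)
      (hK.smooth.continuous_fderiv (by simp)),
    convolution_eq_swap (ContinuousLinearMap.lsmul ℝ ℝ)]
  simpa only [ContinuousLinearMap.lsmul_apply, Complex.real_smul] using! hwx

theorem isTestFunction_convolution {U S : Set Plane} (hS : IsCompact S) {δ : ℝ}
    (hδ : Metric.cthickening δ S ⊆ U) {K : Plane → ℝ}
    (hK : IsTestFunction (Metric.closedBall 0 δ) K)
    {v : Plane → ℂ} (hv : LocallyIntegrable v volume) (hvS : ∀ x ∉ S, v x = 0) :
    IsTestFunction U (K ⋆[ContinuousLinearMap.lsmul ℝ ℝ, volume] v) := by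
  refine ⟨hK.compact.contDiff_convolution_left _ hK.smooth hv,
    hK.compact.convolution _ (HasCompactSupport.intro hS hvS),
    (closure_minimal ?_ Metric.isClosed_cthickening).trans hδ⟩
  refine (support_convolution_subset _).trans ?_
  rintro _ ⟨t, ht, s, hs, rfl⟩
  have hsS : s ∈ S := by
    by_contra hn
    exact hs (hvS s hn)
  refine Metric.mem_cthickening_of_dist_le _ s δ S hsS ?_
  simpa using hK.support_subset (subset_tsupport _ ht)

/-! ### Cutting off `H¹` functions -/

theorem exists_isTestFunction_eLpNorm_sub_le {U S : Set Plane} (hU : IsOpen U) (hS : IsCompact S)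
    (hSU : S ⊆ U) {v : Plane → ℂ} {h : Fin 2 → Plane → ℂ} (hv : MemH1 Set.univ v h)
    (hvS : ∀ x ∉ S, v x = 0) {ε : ℝ≥0∞} (hε : 0 < ε) :
    ∃ φ : Plane → ℂ, IsTestFunction U φ ∧ eLpNorm (v - φ) 2 volume ≤ ε ∧
      ∀ j, eLpNorm (h j - partialDeriv j φ) 2 volume ≤ ε := by
  obtain ⟨hv2, hh2, hw⟩ := hv
  simp only [Measure.restrict_univ] at hv2 hh2 hw
  have hvl : LocallyIntegrable v volume := hv2.locallyIntegrable (by norm_num)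
  obtain ⟨δ, hδ, hδU⟩ := hS.exists_cthickening_subset_open hU hSU
  have hev : ∀ᶠ t in 𝓝 (0 : Plane), eLpNorm (fun x => v x - v (x - t)) 2 volume ≤ ε ∧
      ∀ j, eLpNorm (fun x => h j x - h j (x - t)) 2 volume ≤ ε :=
    ((tendsto_eLpNorm_sub_comp_sub (by simp) hv2).eventually_le_const hε).and
      (eventually_all.2 fun j =>
        (tendsto_eLpNorm_sub_comp_sub (by simp) (hh2 j)).eventually_le_const hε)
  obtain ⟨r, hr, hball⟩ := Metric.nhds_basis_closedBall.eventually_iff.1 hev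
  obtain ⟨K, hK, hK0, hK1⟩ := exists_isTestFunction_closedBall_integral_eq_one (lt_min hr hδ)
  have hKr : Function.support K ⊆ Metric.closedBall 0 r := (subset_tsupport K).trans
    (hK.support_subset.trans (Metric.closedBall_subset_closedBall (min_le_left r δ)))
  refine ⟨K ⋆[ContinuousLinearMap.lsmul ℝ ℝ, volume] v,
    isTestFunction_convolution hS hδU (hK.mono (Metric.closedBall_subset_closedBall
      (min_le_right r δ))) hvl hvS, ?_, fun j => ?_⟩
  · exact eLpNorm_sub_convolution_le (p := 2) (by norm_num) hv2 hK.continuous hK.compact hK0 hK1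
      fun t ht => (hball (hKr ht)).1
  · rw [partialDeriv_convolution hK hvl fun ψ hψ => hw ψ hψ j]
    exact eLpNorm_sub_convolution_le (p := 2) (by norm_num) (hh2 j) hK.continuous hK.compact hK0
      hK1 fun t ht => (hball (hKr ht)).2 j

theorem MemH1.mono {U V : Set Plane} {u : Plane → ℂ} {g : Fin 2 → Plane → ℂ} (hu : MemH1 U u g)
    (hVU : V ⊆ U) : MemH1 V u g where
  memLp := hu.memLp.mono_measure (Measure.restrict_mono hVU le_rfl)
  memLp_grad j := (hu.memLp_grad j).mono_measure (Measure.restrict_mono hVU le_rfl)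
  weak_grad φ hφ j := by
    have h := hu.weak_grad φ (hφ.mono hVU) j
    rw [setIntegral_eq_integral_of_forall_compl_eq_zero
        fun x hx => by rw [(hφ.mono hVU).partialDeriv_eq_zero j hx, Complex.ofReal_zero, zero_mul],
      setIntegral_eq_integral_of_forall_compl_eq_zero
        fun x hx => by rw [(hφ.mono hVU).eq_zero hx, Complex.ofReal_zero, zero_mul]] at h
    rwa [setIntegral_eq_integral_of_forall_compl_eq_zero
        fun x hx => by rw [hφ.partialDeriv_eq_zero j hx, Complex.ofReal_zero, zero_mul],
      setIntegral_eq_integral_of_forall_compl_eq_zero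
        fun x hx => by rw [hφ.eq_zero hx, Complex.ofReal_zero, zero_mul]]

section Cutoff

variable {U : Set Plane} {u : Plane → ℂ} {g : Fin 2 → Plane → ℂ} {χ : Plane → ℝ}

theorem MemH1.integral_partialDeriv_mul_cutoff (hu : MemH1 U u g) (hχ : IsTestFunction U χ)
    {ψ : Plane → ℝ} (hψ : IsTestFunction Set.univ ψ) (j : Fin 2) :
    ∫ x in U, ((partialDeriv j ψ x : ℝ) : ℂ) * ((χ x : ℂ) * u x) =
      -∫ x in U, (ψ x : ℂ) * ((χ x : ℂ) * g j x + ((partialDeriv j χ x : ℝ) : ℂ) * u x) := by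
  have hInt : ∀ {a b : Plane → ℝ} {f : Plane → ℂ}, MemLp a 2 (volume.restrict U) →
      MemLp b ⊤ (volume.restrict U) → MemLp f 2 (volume.restrict U) →
      IntegrableOn (fun x => (a x : ℂ) * ((b x : ℂ) * f x)) U := fun ha hb hf =>
    ha.ofReal.integrable_mul (hf.mul' (r := 2) hb.ofReal)
  have hψ2 := hψ.memLp 2 (volume.restrict U)
  have hdχ := hχ.memLp_partialDeriv j ⊤ (volume.restrict U)
  have h := hu.weak_grad (ψ * χ) (hχ.mul_left hψ.smooth) j
  simp only [partialDeriv_mul hψ.differentiable hχ.differentiable, Pi.mul_apply, Pi.add_apply,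
    Complex.ofReal_add, Complex.ofReal_mul, add_mul, mul_assoc] at h
  rw [integral_add (hInt hψ2 hdχ hu.memLp)
    (hInt (hψ.memLp_partialDeriv j 2 _) (hχ.memLp ⊤ _) hu.memLp)] at h
  simp only [mul_add]
  rw [integral_add (hInt hψ2 (hχ.memLp ⊤ _) (hu.memLp_grad j)) (hInt hψ2 hdχ hu.memLp)]
  linear_combination h

theorem MemH1.cutoff_univ (hU : MeasurableSet U) (hu : MemH1 U u g) (hχ : IsTestFunction U χ) :
    MemH1 Set.univ (fun x => (χ x : ℂ) * u x)
      (fun j x => (χ x : ℂ) * g j x + ((partialDeriv j χ x : ℝ) : ℂ) * u x) := by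
  have hv0 : ∀ x ∉ U, (χ x : ℂ) * u x = 0 := fun x hx => by simp [hχ.eq_zero hx]
  have hh0 : ∀ j, ∀ x ∉ U, (χ x : ℂ) * g j x + ((partialDeriv j χ x : ℝ) : ℂ) * u x = 0 :=
    fun j x hx => by simp [hχ.eq_zero hx, hχ.partialDeriv_eq_zero j hx]
  have hext : ∀ {f : Plane → ℂ}, (∀ x ∉ U, f x = 0) → MemLp f 2 (volume.restrict U) →
      MemLp f 2 (volume.restrict Set.univ) := by
    intro f hf hm
    rwa [Measure.restrict_univ, ← Set.indicator_eq_self.2 (Function.support_subset_iff'.2 hf),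
      memLp_indicator_iff_restrict hU]
  refine ⟨hext hv0 (hu.memLp.mul' (hχ.memLp ⊤ _).ofReal), fun j => hext (hh0 j)
    (((hu.memLp_grad j).mul' (hχ.memLp ⊤ _).ofReal).add
      (hu.memLp.mul' (hχ.memLp_partialDeriv j ⊤ _).ofReal)), fun ψ hψ j => ?_⟩
  have h := hu.integral_partialDeriv_mul_cutoff hχ hψ j
  rwa [setIntegral_eq_integral_of_forall_compl_eq_zero fun x hx => by rw [hv0 x hx, mul_zero],
    setIntegral_eq_integral_of_forall_compl_eq_zero fun x hx => by rw [hh0 j x hx, mul_zero],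
    ← setIntegral_univ, ← setIntegral_univ (f := fun x => (ψ x : ℂ) * _)] at h

theorem MemH1.cutoff (hU : IsOpen U) (hu : MemH1 U u g) (hχ : IsTestFunction U χ) :
    MemH10 U (fun x => (χ x : ℂ) * u x)
      (fun j x => (χ x : ℂ) * g j x + ((partialDeriv j χ x : ℝ) : ℂ) * u x) := by
  have hv := hu.cutoff_univ hU.measurableSet hχ
  have hvU := hv.mono (Set.subset_univ U)
  refine .of_forall_exists_eLpNorm_le hvU.memLp hvU.memLp_grad fun ε hε => ?_
  obtain ⟨φ, hφ, hφ0, hφ1⟩ := exists_isTestFunction_eLpNorm_sub_le hU hχ.compact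
    hχ.support_subset hv (fun x hx => by simp [image_eq_zero_of_notMem_tsupport hx]) hε
  exact ⟨φ, hφ, (eLpNorm_mono_measure _ Measure.restrict_le_self).trans hφ0,
    fun j => (eLpNorm_mono_measure _ Measure.restrict_le_self).trans (hφ1 j)⟩

end Cutoff

/-! ### Mass and Gross-Pitaevskii functional -/

/-- The integrand of `gpFunctional` at the point `x`, for a function with value `z` and gradient `w`
at `x`. -/
noncomputable def gpIntegrand (G : ℝ) (x : Plane) (z : ℂ) (w : Fin 2 → ℂ) : ℝ :=
  (1 / 2) * ((∑ j, ‖-Complex.I * w j - (perp x j : ℂ) * z‖ ^ 2) + G * ‖z‖ ^ 4)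

section Functional

variable {G : ℝ} {U : Set Plane} {u : Plane → ℂ} {g : Fin 2 → Plane → ℂ}

theorem gpFunctional_eq_lintegral (G : ℝ) (U : Set Plane) (u : Plane → ℂ)
    (g : Fin 2 → Plane → ℂ) :
    gpFunctional G U u g = ∫⁻ x in U, ENNReal.ofReal (gpIntegrand G x (u x) (g · x)) :=
  rfl

theorem gpIntegrand_nonneg (hG : 0 ≤ G) (x : Plane) (z : ℂ) (w : Fin 2 → ℂ) :
    0 ≤ gpIntegrand G x z w := by
  unfold gpIntegrand
  positivity

theorem gpIntegrand_zero (G : ℝ) (x : Plane) : gpIntegrand G x 0 0 = 0 := by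
  simp [gpIntegrand]

theorem gpIntegrand_const_mul_le (hG : 0 ≤ G) (x : Plane) {a z : ℂ} {c : ℝ} (hc : 1 ≤ c)
    (ha : ‖a‖ ^ 2 ≤ c) (w : Fin 2 → ℂ) :
    gpIntegrand G x (a * z) (fun j => a * w j) ≤ c ^ 2 * gpIntegrand G x z w := by
  have hgrad : ∀ j, ‖-Complex.I * (a * w j) - (perp x j : ℂ) * (a * z)‖ ^ 2 ≤
      c ^ 2 * ‖-Complex.I * w j - (perp x j : ℂ) * z‖ ^ 2 := fun j => by
    calc ‖-Complex.I * (a * w j) - (perp x j : ℂ) * (a * z)‖ ^ 2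
        = ‖a‖ ^ 2 * ‖-Complex.I * w j - (perp x j : ℂ) * z‖ ^ 2 := by
          rw [← mul_pow, ← norm_mul]
          ring_nf
      _ ≤ c ^ 2 * ‖-Complex.I * w j - (perp x j : ℂ) * z‖ ^ 2 := by
          gcongr
          nlinarith
  have hquartic : G * ‖a * z‖ ^ 4 ≤ c ^ 2 * (G * ‖z‖ ^ 4) := by
    calc G * ‖a * z‖ ^ 4 = (‖a‖ ^ 2) ^ 2 * (G * ‖z‖ ^ 4) := by rw [norm_mul]; ring
      _ ≤ c ^ 2 * (G * ‖z‖ ^ 4) := by gcongr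
  have hsum := Finset.sum_le_sum fun j (_ : j ∈ Finset.univ) => hgrad j
  rw [← Finset.mul_sum] at hsum
  unfold gpIntegrand
  linarith

theorem gpFunctional_const_mul_le (hG : 0 ≤ G) {c : ℝ≥0} (hc : 1 ≤ c) {a : ℂ} (ha : ‖a‖ ^ 2 ≤ c) :
    gpFunctional G U (fun x => a * u x) (fun j x => a * g j x) ≤
      (c : ℝ≥0∞) ^ 2 * gpFunctional G U u g := by
  rw [gpFunctional_eq_lintegral, gpFunctional_eq_lintegral, ← ENNReal.coe_pow,
    ← lintegral_const_mul' _ _ ENNReal.coe_ne_top]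
  refine lintegral_mono fun x => ?_
  rw [← ENNReal.ofReal_coe_nnreal, ← ENNReal.ofReal_mul (by positivity), NNReal.coe_pow]
  exact ENNReal.ofReal_le_ofReal (gpIntegrand_const_mul_le hG x (by exact_mod_cast hc) ha _)

theorem mass_eq_eLpNorm_sq (U : Set Plane) (u : Plane → ℂ) :
    mass U u = eLpNorm u 2 (volume.restrict U) ^ 2 := by
  have h := eLpNorm_nnreal_pow_eq_lintegral (f := u) (p := 2) (μ := volume.restrict U) two_ne_zero
  simp only [NNReal.coe_ofNat, ENNReal.rpow_ofNat, ENNReal.coe_ofNat] at h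
  simp only [h, mass, ENNReal.ofReal_pow (norm_nonneg _), ofReal_norm]

theorem MemH1.mass_ne_top (hu : MemH1 U u g) : mass U u ≠ ⊤ := by
  rw [mass_eq_eLpNorm_sq]
  exact ENNReal.pow_ne_top hu.memLp.2.ne

theorem mass_const_mul (U : Set Plane) (a : ℂ) (u : Plane → ℂ) :
    mass U (fun x => a * u x) = ‖a‖ₑ ^ 2 * mass U u := by
  rw [mass_eq_eLpNorm_sq, mass_eq_eLpNorm_sq, ← mul_pow, ← eLpNorm_const_smul]
  rfl

theorem setLIntegral_indicator_add_indicator {α E F : Type*} [MeasurableSpace α] {μ : Measure α}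
    [AddZeroClass E] [AddZeroClass F] {U V W : Set α} (hU : MeasurableSet U)
    (hV : MeasurableSet V) (hUV : Disjoint U V) (hUW : U ⊆ W) (hVW : V ⊆ W) {ι : Type*}
    {Φ : α → E → (ι → F) → ℝ≥0∞} (hΦ : ∀ x, Φ x 0 0 = 0) (u v : α → E) (g h : ι → α → F) :
    ∫⁻ x in W, Φ x ((U.indicator u + V.indicator v) x)
        (fun j => (U.indicator (g j) + V.indicator (h j)) x) ∂μ =
      (∫⁻ x in U, Φ x (u x) (g · x) ∂μ) + ∫⁻ x in V, Φ x (v x) (h · x) ∂μ := by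
  set Ψ : α → ℝ≥0∞ := fun x => Φ x ((U.indicator u + V.indicator v) x)
    (fun j => (U.indicator (g j) + V.indicator (h j)) x)
  have hΨ : Ψ = (U ∪ V).indicator Ψ := by
    refine (Set.indicator_eq_self.2 (Function.support_subset_iff'.2 fun x hx => ?_)).symm
    rw [Set.mem_union, not_or] at hx
    simpa [Ψ, hx.1, hx.2, Pi.zero_def] using hΦ x
  rw [hΨ, setLIntegral_indicator (hU.union hV), Set.inter_eq_left.2 (Set.union_subset hUW hVW),
    lintegral_union hV hUV]
  congr 1
  · refine setLIntegral_congr_fun hU fun x hx => ?_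
    simp [Ψ, hx, hUV.notMem_of_mem_left hx]
  · refine setLIntegral_congr_fun hV fun x hx => ?_
    simp [Ψ, hx, hUV.notMem_of_mem_right hx]

end Functional

/-! ### The Dirichlet energy -/

section DirichletEnergy

variable {G : ℝ} {U V W : Set Plane} {u : Plane → ℂ} {g : Fin 2 → Plane → ℂ} {M M' : ℝ≥0∞}

theorem dirichletEnergy_mass_le (hu : MemH10 U u g) :
    dirichletEnergy G U (mass U u) ≤ gpFunctional G U u g :=
  sInf_le ⟨u, g, hu, rfl, rfl⟩

theorem le_dirichletEnergy {E : ℝ≥0∞}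
    (h : ∀ u g, MemH10 U u g → mass U u = M → E ≤ gpFunctional G U u g) :
    E ≤ dirichletEnergy G U M :=
  le_sInf fun _ ⟨u, g, hu, hM, hE⟩ => hE ▸ h u g hu hM

theorem neumannEnergy_le_dirichletEnergy (G : ℝ) (U : Set Plane) (M : ℝ≥0∞) :
    neumannEnergy G U M ≤ dirichletEnergy G U M :=
  sInf_le_sInf fun _ ⟨u, g, hu, hM, hE⟩ => ⟨u, g, hu.toMemH1, hM, hE⟩

theorem dirichletEnergy_zero (G : ℝ) (U : Set Plane) : dirichletEnergy G U 0 = 0 := by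
  have h0 : MemH10 U 0 (fun j => partialDeriv j (0 : Plane → ℂ)) := .of_isTestFunction
    ⟨contDiff_const, HasCompactSupport.zero, by simp [tsupport]⟩
  simpa [gpFunctional, mass, partialDeriv] using dirichletEnergy_mass_le (G := G) h0

theorem dirichletEnergy_add_le (G : ℝ) (hU : MeasurableSet U) (hV : MeasurableSet V)
    (hUV : Disjoint U V) (hUW : U ⊆ W) (hVW : V ⊆ W) (M N : ℝ≥0∞) :
    dirichletEnergy G W (M + N) ≤ dirichletEnergy G U M + dirichletEnergy G V N := by
  rw [dirichletEnergy.eq_def G U, dirichletEnergy.eq_def G V, sInf_eq_iInf', sInf_eq_iInf']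
  refine ENNReal.le_iInf_add_iInf ?_
  rintro ⟨_, u, g, hu, rfl, rfl⟩ ⟨_, v, h, hv, rfl, rfl⟩
  have hadd := (hu.indicator hU hUW).add (hv.indicator hV hVW)
  have hmass : mass W (U.indicator u + V.indicator v) = mass U u + mass V v :=
    setLIntegral_indicator_add_indicator hU hV hUV hUW hVW
      (Φ := fun _ z _ => ENNReal.ofReal (‖z‖ ^ 2)) (by simp) u v g h
  rw [← hmass]
  refine (dirichletEnergy_mass_le hadd).trans (le_of_eq ?_)
  exact setLIntegral_indicator_add_indicator hU hV hUV hUW hVW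
    (Φ := fun x z w => ENNReal.ofReal (gpIntegrand G x z w)) (by simp [gpIntegrand_zero]) u v g h

theorem dirichletEnergy_anti (G : ℝ) (hU : MeasurableSet U) (hUV : U ⊆ V) (M : ℝ≥0∞) :
    dirichletEnergy G V M ≤ dirichletEnergy G U M := by
  simpa [dirichletEnergy_zero] using dirichletEnergy_add_le G hU MeasurableSet.empty
    (Set.disjoint_empty U) hUV (Set.empty_subset V) M 0

theorem dirichletEnergy_biUnion_le (G : ℝ) {ι : Type*} (s : Finset ι) {U : ι → Set Plane}
    (M : ι → ℝ≥0∞) (hU : ∀ i, MeasurableSet (U i)) (hd : (s : Set ι).PairwiseDisjoint U) :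
    dirichletEnergy G (⋃ i ∈ s, U i) (∑ i ∈ s, M i) ≤ ∑ i ∈ s, dirichletEnergy G (U i) (M i) := by
  classical
  induction s using Finset.induction_on with
  | empty => simp [dirichletEnergy_zero]
  | insert a s ha ih =>
    rw [Finset.coe_insert, Set.pairwiseDisjoint_insert_of_notMem (by simpa using ha)] at hd
    rw [Finset.sum_insert ha, Finset.sum_insert ha]
    refine (dirichletEnergy_add_le G (hU a) (s.measurableSet_biUnion fun i _ => hU i)
      (Set.disjoint_iUnion₂_right.2 fun i hi => hd.2 i hi) ?_ ?_ _ _).trans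
      (add_le_add_right (ih hd.1) _)
    · exact Set.subset_biUnion_of_mem (u := U) (Finset.mem_insert_self a s)
    · exact Set.biUnion_subset_biUnion_left fun i hi => Finset.mem_insert_of_mem hi

theorem dirichletEnergy_le_sq_mul (hG : 0 ≤ G) {c : ℝ≥0} (hc : 1 ≤ c) (hM : M' ≤ c * M) :
    dirichletEnergy G U M' ≤ (c : ℝ≥0∞) ^ 2 * dirichletEnergy G U M := by
  have hc0 : (c : ℝ≥0∞) ^ 2 ≠ 0 := pow_ne_zero 2 (ENNReal.coe_ne_zero.2 (by positivity))
  rw [← ENNReal.div_le_iff' hc0 (by simp)]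
  refine le_dirichletEnergy fun u g hu hMu => ?_
  rw [ENNReal.div_le_iff' hc0 (by simp)]
  have hMt : M ≠ ⊤ := hMu ▸ hu.mass_ne_top
  obtain ⟨a, hac, rfl⟩ : ∃ a : ℝ≥0, a ≤ c ∧ a * M = M' := by
    lift M to ℝ≥0 using hMt
    lift M' to ℝ≥0 using ne_top_of_le_ne_top (by finiteness) hM
    norm_cast at hM ⊢
    exact ⟨M' / M, div_le_of_le_mul₀ zero_le zero_le hM,
      div_mul_cancel_of_imp fun h => by simpa [h] using hM⟩
  have hsqrt : ‖(NNReal.sqrt a : ℂ)‖₊ ^ 2 = a := by simp [← NNReal.coe_inj]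
  have hmass : mass U (fun x => (NNReal.sqrt a : ℂ) * u x) = a * M := by
    rw [mass_const_mul, hMu, enorm_eq_nnnorm, ← ENNReal.coe_pow, hsqrt]
  rw [← hmass]
  exact (dirichletEnergy_mass_le (hu.const_mul _)).trans
    (gpFunctional_const_mul_le hG hc (by exact_mod_cast hsqrt.trans_le hac))

end DirichletEnergy

/-! ### Magnetic translations -/

/-- The phase by which a translation by `a` has to be multiplied in order to commute with the
magnetic momentum `-i∇ - x^⊥`. -/
noncomputable def magneticPhase (a x : Plane) : ℂ :=
  Complex.exp ((inner ℝ (perp a) x : ℝ) * Complex.I)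

section MagneticTranslation

variable {G : ℝ} {U : Set Plane} {u : Plane → ℂ} {g : Fin 2 → Plane → ℂ}

theorem perp_sub (x y : Plane) (j : Fin 2) : perp (x - y) j = perp x j - perp y j := by
  fin_cases j <;> simp [perp, neg_add_eq_sub]

theorem norm_magneticPhase (a x : Plane) : ‖magneticPhase a x‖ = 1 :=
  Complex.norm_exp_ofReal_mul_I _

theorem hasFDerivAt_magneticPhase (a x : Plane) :
    HasFDerivAt (magneticPhase a)
      (magneticPhase a x • (innerSL ℝ (perp a)).smulRight Complex.I) x := by
  have h : HasFDerivAt (fun x => ((inner ℝ (perp a) x : ℝ) : ℂ) * Complex.I)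
      ((innerSL ℝ (perp a)).smulRight Complex.I) x :=
    ((innerSL ℝ (perp a)).smulRight Complex.I).hasFDerivAt
  exact h.cexp

theorem partialDeriv_magneticPhase (a x : Plane) (j : Fin 2) :
    partialDeriv j (magneticPhase a) x = magneticPhase a x * (perp a j * Complex.I) := by
  simp [partialDeriv, (hasFDerivAt_magneticPhase a x).fderiv, EuclideanSpace.inner_single_right]

theorem contDiff_magneticPhase (a : Plane) : ContDiff ℝ ∞ (magneticPhase a) := by
  have h : ContDiff ℝ ∞ fun x => ((inner ℝ (perp a) x : ℝ) : ℂ) * Complex.I :=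
    ((innerSL ℝ (perp a)).smulRight Complex.I).contDiff
  exact h.cexp

theorem MemH10.magneticTranslation (hU : MeasurableSet U) (hu : MemH10 U u g) (a : Plane) :
    MemH10 ((fun x => x - a) ⁻¹' U) (magneticPhase a * fun x => u (x - a))
      (fun j => magneticPhase a * (fun x => g j (x - a)) +
        partialDeriv j (magneticPhase a) * fun x => u (x - a)) := by
  have ha := contDiff_magneticPhase a
  refine (hu.comp_sub hU a).mul_left ha ?_ fun j => ?_
  · exact memLp_top_of_bound ha.continuous.aestronglyMeasurable 1
      (Eventually.of_forall fun x => (norm_magneticPhase a x).le)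
  · refine memLp_top_of_bound (continuous_partialDeriv ha j).aestronglyMeasurable |perp a j|
      (Eventually.of_forall fun x => ?_)
    simp [partialDeriv_magneticPhase, norm_magneticPhase]

theorem gpIntegrand_magneticTranslation (G : ℝ) (a x : Plane) (z : ℂ) (w : Fin 2 → ℂ) :
    gpIntegrand G x (magneticPhase a x * z)
        (fun j => magneticPhase a x * w j + partialDeriv j (magneticPhase a) x * z) =
      gpIntegrand G (x - a) z w := by
  have hgrad : ∀ j, ‖-Complex.I * (magneticPhase a x * w j + partialDeriv j (magneticPhase a) x * z)
      - (perp x j : ℂ) * (magneticPhase a x * z)‖ =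
      ‖-Complex.I * w j - (perp (x - a) j : ℂ) * z‖ := fun j => by
    rw [← one_mul ‖-Complex.I * w j - _‖, ← norm_magneticPhase a x, ← norm_mul, perp_sub,
      Complex.ofReal_sub, partialDeriv_magneticPhase]
    congr 1
    linear_combination (-magneticPhase a x * perp a j * z) * Complex.I_sq
  simp only [gpIntegrand, hgrad, norm_mul, norm_magneticPhase, one_mul]

theorem dirichletEnergy_preimage_sub_le (G : ℝ) (hU : MeasurableSet U) (a : Plane) (M : ℝ≥0∞) :
    dirichletEnergy G ((fun x => x - a) ⁻¹' U) M ≤ dirichletEnergy G U M := by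
  have hmp : ∀ F : Plane → ℝ≥0∞, ∫⁻ x in (fun x => x - a) ⁻¹' U, F (x - a) = ∫⁻ x in U, F x :=
    (measurePreserving_sub_right volume a).setLIntegral_comp_preimage_emb
      (Homeomorph.subRight a).measurableEmbedding (s := U)
  refine le_dirichletEnergy fun u g hu hM => ?_
  have hmass : mass ((fun x => x - a) ⁻¹' U) (magneticPhase a * fun x => u (x - a)) = M := by
    simp [← hM, mass, ← hmp, norm_magneticPhase]
  rw [← hmass, gpFunctional_eq_lintegral, ← hmp]
  refine (dirichletEnergy_mass_le (hu.magneticTranslation hU a)).trans_eq ?_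
  exact lintegral_congr fun x => by
    rw [← gpIntegrand_magneticTranslation]
    rfl

theorem dirichletEnergy_preimage_sub (G : ℝ) (hU : MeasurableSet U) (a : Plane) (M : ℝ≥0∞) :
    dirichletEnergy G ((fun x => x - a) ⁻¹' U) M = dirichletEnergy G U M := by
  refine (dirichletEnergy_preimage_sub_le G hU a M).antisymm ?_
  have h := dirichletEnergy_preimage_sub_le G (hU.preimage (measurable_sub_const a)) (-a) M
  simpa [← Set.preimage_comp, Function.comp_def] using h

end MagneticTranslation

/-! ### Finiteness of the Dirichlet energy -/

theorem exists_isTestFunction_eqOn_one {C U : Set Plane} (hC : IsCompact C) (hU : IsOpen U)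
    (hCU : C ⊆ U) :
    ∃ χ : Plane → ℝ, IsTestFunction U χ ∧ (∀ x, χ x ∈ Set.Icc (0 : ℝ) 1) ∧ Set.EqOn χ 1 C := by
  obtain ⟨V, hV, hCV, hVU, hVc⟩ := exists_open_between_and_isCompact_closure hC hU hCU
  obtain ⟨χ, hχ, hrange, hsupp, hone⟩ := exists_contMDiff_support_eq_eq_one_iff
    (modelWithCornersSelf ℝ Plane) (n := ⊤) hV hC.isClosed hCV
  have hχV : tsupport χ = closure V := by rw [tsupport, hsupp]
  exact ⟨χ, ⟨hχ.contDiff, (congrArg IsCompact hχV).mpr hVc, hχV.trans_subset hVU⟩,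
    fun x => hrange ⟨x, rfl⟩, fun x hx => (hone x).1 hx⟩

theorem IsTestFunction.ofReal {U : Set Plane} {φ : Plane → ℝ} (h : IsTestFunction U φ) :
    IsTestFunction U fun x => (φ x : ℂ) :=
  ⟨Complex.ofRealCLM.contDiff.comp h.smooth, h.compact.comp_left Complex.ofReal_zero,
    (closure_mono (Function.support_comp_subset Complex.ofReal_zero φ)).trans h.support_subset⟩

@[fun_prop]
theorem continuous_perp (j : Fin 2) : Continuous fun x => perp x j := by
  fin_cases j <;> simp only [perp] <;> fun_prop

theorem IsTestFunction.gpFunctional_ne_top {U : Set Plane} {φ : Plane → ℂ}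
    (h : IsTestFunction U φ) (G : ℝ) :
    gpFunctional G U φ (fun j => partialDeriv j φ) ≠ ⊤ := by
  have hcont : Continuous fun x => gpIntegrand G x (φ x) fun j => partialDeriv j φ x := by
    have h0 := h.continuous
    have h1 := h.continuous_partialDeriv
    unfold gpIntegrand
    fun_prop
  have hsupp : HasCompactSupport fun x => gpIntegrand G x (φ x) fun j => partialDeriv j φ x := by
    refine HasCompactSupport.intro h.compact fun x hx => ?_
    have h' : IsTestFunction (tsupport φ) φ := ⟨h.smooth, h.compact, subset_rfl⟩
    simp only [h'.eq_zero hx, h'.partialDeriv_eq_zero _ hx]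
    exact gpIntegrand_zero G x
  exact (hcont.integrable_of_hasCompactSupport hsupp).integrableOn.lintegral_lt_top.ne

theorem exists_isTestFunction_mass_ne_zero {U : Set Plane} (hU : IsOpen U) (hU' : U.Nonempty) :
    ∃ φ : Plane → ℂ, IsTestFunction U φ ∧ mass U φ ≠ 0 := by
  obtain ⟨x, hx⟩ := hU'
  obtain ⟨χ, hχ, -, hχx⟩ := exists_isTestFunction_eqOn_one isCompact_singleton hU
    (Set.singleton_subset_iff.2 hx)
  refine ⟨_, hχ.ofReal, fun h0 => ?_⟩
  rw [mass_eq_eLpNorm_sq, sq_eq_zero_iff,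
    eLpNorm_eq_zero_iff (hχ.ofReal.memLp 2 _).1 two_ne_zero] at h0
  have hχ0 := Measure.eqOn_open_of_ae_eq h0 hU hχ.ofReal.continuous.continuousOn
    continuousOn_const hx
  simp [hχx rfl] at hχ0

theorem dirichletEnergy_ne_top {G : ℝ} (hG : 0 ≤ G) {U : Set Plane} (hU : IsOpen U)
    (hU' : U.Nonempty) {M : ℝ≥0∞} (hM : M ≠ ⊤) : dirichletEnergy G U M ≠ ⊤ := by
  obtain ⟨φ, hφ, hφ0⟩ := exists_isTestFunction_mass_ne_zero hU hU'
  have hφM : M / mass U φ ≠ ⊤ := ENNReal.div_ne_top hM hφ0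
  have hle : M ≤ (max 1 (M / mass U φ).toNNReal : ℝ≥0) * mass U φ := by
    calc M = M / mass U φ * mass U φ := by
          rw [ENNReal.div_mul_cancel hφ0 (MemH10.of_isTestFunction hφ).mass_ne_top]
      _ ≤ _ := by
          gcongr
          rw [← ENNReal.coe_toNNReal hφM]
          exact_mod_cast le_max_right _ _
  refine ne_top_of_le_ne_top ?_ (dirichletEnergy_le_sq_mul hG (le_max_left _ _) hle)
  have hfin := ne_top_of_le_ne_top (hφ.gpFunctional_ne_top G)
    (dirichletEnergy_mass_le (.of_isTestFunction hφ))
  finiteness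

/-! ### Packing squares into dilated sets -/

theorem eventually_cthickening_smul_subset {E : Type*} [NormedAddCommGroup E] [NormedSpace ℝ E]
    {K V : Set E} (hK : IsCompact K) (hV : IsOpen V) (hKV : K ⊆ V) (r : ℝ) :
    ∀ᶠ L : ℝ in atTop, Metric.cthickening r (L • K) ⊆ L • V := by
  obtain ⟨δ, hδ, hδV⟩ := hK.exists_cthickening_subset_open hV hKV
  filter_upwards [eventually_gt_atTop 0, eventually_ge_atTop (r / δ)] with L hL hLδ x hx
  rw [Set.mem_smul_set_iff_inv_smul_mem₀ hL.ne']
  refine hδV (Metric.mem_cthickening_iff.2 ?_)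
  rw [Metric.mem_cthickening_iff, ← smul_inv_smul₀ hL.ne' x, infEDist_smul₀ hL.ne',
    ENNReal.smul_def, smul_eq_mul, ← enorm_eq_nnnorm, Real.enorm_of_nonneg hL.le] at hx
  refine (ENNReal.mul_le_mul_iff_right (ENNReal.ofReal_pos.2 hL).ne' ENNReal.ofReal_ne_top).1
    (hx.trans ?_)
  rw [← ENNReal.ofReal_mul hL.le]
  exact ENNReal.ofReal_le_ofReal ((div_le_iff₀ hδ).1 hLδ)

theorem volume_setOf_forall_apply_mem {ι : Type*} [Fintype ι] {I : ι → Set ℝ}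
    (hI : ∀ j, MeasurableSet (I j)) :
    volume {x : EuclideanSpace ℝ ι | ∀ j, x j ∈ I j} = ∏ j, volume (I j) := by
  rw [← volume_pi_pi, ← (PiLp.volume_preserving_ofLp ι).measure_preimage
    (MeasurableSet.univ_pi hI).nullMeasurableSet]
  congr 1
  ext x
  simp

/-- The open square with lower left corner `a` and side `ℓ`. -/
def openSquare (a : Plane) (ℓ : ℝ) : Set Plane := {x | ∀ j, x j ∈ Set.Ioo (a j) (a j + ℓ)}

/-- The points of the lattice `ℓ ℤ²`. -/
noncomputable def gridPoint (ℓ : ℝ) (k : Fin 2 → ℤ) : Plane := WithLp.toLp 2 fun j => ℓ * k j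

/-- The half-open squares of side `ℓ`, indexed by their lower left corner in `ℓ ℤ²`, which tile the
plane when `ℓ > 0`. -/
def gridCell (ℓ : ℝ) (k : Fin 2 → ℤ) : Set Plane := {x | ∀ j, ⌊x j / ℓ⌋ = k j}

section Squares

variable {ℓ : ℝ} {k : Fin 2 → ℤ}

theorem volume_openSquare (a : Plane) (ℓ : ℝ) :
    volume (openSquare a ℓ) = ENNReal.ofReal ℓ ^ 2 := by
  refine (volume_setOf_forall_apply_mem fun _ => measurableSet_Ioo).trans ?_
  simp

theorem volume_openSquare_ne_top (a : Plane) (ℓ : ℝ) : volume (openSquare a ℓ) ≠ ⊤ := by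
  simp [volume_openSquare]

theorem volume_openSquare_ne_zero (a : Plane) (hℓ : 0 < ℓ) : volume (openSquare a ℓ) ≠ 0 := by
  simp [volume_openSquare, hℓ]

theorem isOpen_openSquare (a : Plane) (ℓ : ℝ) : IsOpen (openSquare a ℓ) := by
  simp only [openSquare, Set.ofPred_forall]
  exact isOpen_iInter_of_finite fun j => isOpen_Ioo.preimage (by fun_prop)

theorem openSquare_eq_preimage (a : Plane) (ℓ : ℝ) :
    openSquare a ℓ = (fun x => x - a) ⁻¹' openSquare 0 ℓ := by
  ext x
  simp [openSquare, sub_lt_iff_lt_add']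

theorem smul_openSquare {L : ℝ} (hL : 0 < L) (a : Plane) (ℓ : ℝ) :
    L • openSquare a ℓ = openSquare (L • a) (L * ℓ) := by
  ext x
  rw [Set.mem_smul_set_iff_inv_smul_mem₀ hL.ne']
  refine forall_congr' fun j => ?_
  simp only [PiLp.smul_apply, smul_eq_mul, Set.mem_Ioo, ← mul_add]
  rw [lt_inv_mul_iff₀ hL, inv_mul_lt_iff₀ hL]

theorem exists_subset_openSquare {S : Set Plane} (hS : Bornology.IsBounded S) :
    ∃ (a : Plane) (ℓ : ℝ), 0 < ℓ ∧ S ⊆ openSquare a ℓ := by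
  obtain ⟨R, hR0, hR⟩ := hS.exists_pos_norm_lt
  refine ⟨WithLp.toLp 2 fun _ => -R, 2 * R, by positivity, fun x hx j => ?_⟩
  have hj := abs_lt.1 ((PiLp.norm_apply_le x j).trans_lt (hR x hx))
  exact ⟨hj.1, by simpa [two_mul] using hj.2⟩

theorem gridCell_eq (hℓ : 0 < ℓ) (k : Fin 2 → ℤ) :
    gridCell ℓ k = {x | ∀ j, x j ∈ Set.Ico (gridPoint ℓ k j) (gridPoint ℓ k j + ℓ)} := by
  ext x
  refine forall_congr' fun j => ?_
  rw [Int.floor_eq_iff, le_div_iff₀' hℓ, div_lt_iff₀' hℓ, mul_add, mul_one]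
  rfl

theorem openSquare_subset_gridCell (hℓ : 0 < ℓ) (k : Fin 2 → ℤ) :
    openSquare (gridPoint ℓ k) ℓ ⊆ gridCell ℓ k := by
  rw [gridCell_eq hℓ]
  exact fun x hx j => Set.Ioo_subset_Ico_self (hx j)

theorem volume_gridCell (hℓ : 0 < ℓ) (k : Fin 2 → ℤ) :
    volume (gridCell ℓ k) = volume (openSquare 0 ℓ) := by
  rw [gridCell_eq hℓ, volume_openSquare]
  refine (volume_setOf_forall_apply_mem fun _ => measurableSet_Ico).trans ?_
  simp

theorem pairwiseDisjoint_openSquare_gridPoint (hℓ : 0 < ℓ) (s : Set (Fin 2 → ℤ)) :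
    s.PairwiseDisjoint fun k => openSquare (gridPoint ℓ k) ℓ :=
  fun _ _ _ _ hne => Set.disjoint_left.2 fun _ hx hx' => hne <| funext fun j =>
    (openSquare_subset_gridCell hℓ _ hx j).symm.trans (openSquare_subset_gridCell hℓ _ hx' j)

theorem dist_le_of_mem_gridCell (hℓ : 0 < ℓ) {x y : Plane} (hx : x ∈ gridCell ℓ k)
    (hy : y ∈ gridCell ℓ k) : dist x y ≤ 2 * ℓ := by
  rw [gridCell_eq hℓ] at hx hy
  have hj : ∀ j, dist (x j) (y j) ^ 2 ≤ ℓ ^ 2 := fun j => by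
    rw [Real.dist_eq, sq_abs]
    exact sq_le_sq' (by linarith [(hx j).1, (hy j).2]) (by linarith [(hx j).2, (hy j).1])
  rw [EuclideanSpace.dist_eq, Fin.sum_univ_two]
  exact Real.sqrt_le_iff.2 ⟨by positivity, by nlinarith [hj 0, hj 1]⟩

theorem exists_finset_gridCell (hℓ : 0 < ℓ) {S V : Set Plane} (hS : Bornology.IsBounded S)
    (hSV : Metric.cthickening (2 * ℓ) S ⊆ V) :
    ∃ s : Finset (Fin 2 → ℤ), S ⊆ ⋃ k ∈ s, gridCell ℓ k ∧ ∀ k ∈ s, gridCell ℓ k ⊆ V := by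
  let index (x : Plane) (j : Fin 2) : ℤ := ⌊x j / ℓ⌋
  have hfin : (index '' S).Finite := by
    obtain ⟨R, hR⟩ := hS.exists_norm_le
    refine (Set.finite_Icc (fun _ => ⌊-R / ℓ⌋) (fun _ => ⌊R / ℓ⌋)).subset ?_
    rintro _ ⟨x, hx, rfl⟩
    have hj : ∀ j, |x j| ≤ R := fun j => (PiLp.norm_apply_le x j).trans (hR x hx)
    constructor <;> intro j <;> dsimp only [index] <;> gcongr
    exacts [(abs_le.1 (hj j)).1, (abs_le.1 (hj j)).2]
  refine ⟨hfin.toFinset, fun x hx => ?_, fun k hk y hy => ?_⟩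
  · exact Set.mem_biUnion (hfin.mem_toFinset.2 ⟨x, hx, rfl⟩) fun _ => rfl
  · obtain ⟨x, hx, rfl⟩ := hfin.mem_toFinset.1 hk
    exact hSV (Metric.mem_cthickening_of_dist_le y x _ S hx
      (dist_le_of_mem_gridCell hℓ hy fun _ => rfl))

end Squares

section Packing

variable {G ℓ : ℝ} {ρ : ℝ≥0∞} {U V K : Set Plane}

/-- The Dirichlet energy per unit area of `U` at density `ρ`. -/
noncomputable def dirichletDensity (G : ℝ) (ρ : ℝ≥0∞) (U : Set Plane) : ℝ≥0∞ :=
  dirichletEnergy G U (ρ * volume U) / volume U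

theorem volume_mul_dirichletDensity (hU0 : volume U ≠ 0) (hUt : volume U ≠ ⊤) :
    volume U * dirichletDensity G ρ U = dirichletEnergy G U (ρ * volume U) :=
  ENNReal.mul_div_cancel hU0 hUt

theorem dirichletEnergy_openSquare (G : ℝ) (a : Plane) (ℓ : ℝ) (M : ℝ≥0∞) :
    dirichletEnergy G (openSquare a ℓ) M = dirichletEnergy G (openSquare 0 ℓ) M := by
  rw [openSquare_eq_preimage a,
    dirichletEnergy_preimage_sub G (isOpen_openSquare 0 ℓ).measurableSet]

theorem dirichletDensity_openSquare (G : ℝ) (ρ : ℝ≥0∞) (a : Plane) (ℓ : ℝ) :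
    dirichletDensity G ρ (openSquare a ℓ) = dirichletDensity G ρ (openSquare 0 ℓ) := by
  simp only [dirichletDensity, dirichletEnergy_openSquare G a, volume_openSquare]

theorem dirichletEnergy_biUnion_openSquare_le (G : ℝ) (ρ : ℝ≥0∞) (hℓ : 0 < ℓ)
    (s : Finset (Fin 2 → ℤ)) :
    dirichletEnergy G (⋃ k ∈ s, openSquare (gridPoint ℓ k) ℓ)
        (ρ * (s.card * volume (openSquare 0 ℓ))) ≤
      s.card * volume (openSquare 0 ℓ) * dirichletDensity G ρ (openSquare 0 ℓ) := by
  have h := dirichletEnergy_biUnion_le G s (fun _ => ρ * volume (openSquare 0 ℓ))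
    (fun k => (isOpen_openSquare (gridPoint ℓ k) ℓ).measurableSet)
    (pairwiseDisjoint_openSquare_gridPoint hℓ _)
  simp only [dirichletEnergy_openSquare G (gridPoint ℓ _), ← volume_mul_dirichletDensity
    (volume_openSquare_ne_zero 0 hℓ) (volume_openSquare_ne_top 0 ℓ), Finset.sum_const,
    nsmul_eq_mul] at h
  rwa [mul_left_comm, mul_assoc]

theorem exists_packing (G : ℝ) (ρ : ℝ≥0∞) (hℓ : 0 < ℓ) {S : Set Plane}
    (hS : Bornology.IsBounded S) (hSV : Metric.cthickening (2 * ℓ) S ⊆ V) :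
    ∃ N : ℝ≥0∞, volume S ≤ N ∧ N ≤ volume V ∧
      dirichletEnergy G V (ρ * N) ≤ N * dirichletDensity G ρ (openSquare 0 ℓ) := by
  obtain ⟨s, hcover, hsub⟩ := exists_finset_gridCell hℓ hS hSV
  have hopen : ∀ k : Fin 2 → ℤ, MeasurableSet (openSquare (gridPoint ℓ k) ℓ) :=
    fun k => (isOpen_openSquare _ _).measurableSet
  have hsubV : ⋃ k ∈ s, openSquare (gridPoint ℓ k) ℓ ⊆ V :=
    Set.iUnion₂_subset fun k hk => (openSquare_subset_gridCell hℓ k).trans (hsub k hk)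
  refine ⟨s.card * volume (openSquare 0 ℓ), ?_, ?_, ?_⟩
  · refine (measure_mono hcover).trans ((measure_biUnion_finset_le _ _).trans_eq ?_)
    simp only [volume_gridCell hℓ, Finset.sum_const, nsmul_eq_mul]
  · refine (Eq.le ?_).trans (measure_mono hsubV)
    rw [measure_biUnion_finset (pairwiseDisjoint_openSquare_gridPoint hℓ _) fun k _ => hopen k]
    simp only [volume_openSquare, Finset.sum_const, nsmul_eq_mul]
  · exact (dirichletEnergy_anti G (s.measurableSet_biUnion fun k _ => hopen k) hsubV _).trans
      (dirichletEnergy_biUnion_openSquare_le G ρ hℓ s)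

theorem eventually_exists_packing (G : ℝ) (ρ : ℝ≥0∞) (hℓ : 0 < ℓ) (hK : IsCompact K)
    (hV : IsOpen V) (hKV : K ⊆ V) :
    ∀ᶠ L : ℝ in atTop, ∃ N : ℝ≥0∞, volume (L • K) ≤ N ∧ N ≤ volume (L • V) ∧
      dirichletEnergy G (L • V) (ρ * N) ≤ N * dirichletDensity G ρ (openSquare 0 ℓ) := by
  filter_upwards [eventually_cthickening_smul_subset hK hV hKV (2 * ℓ)] with L hL
  exact exists_packing G ρ hℓ (hK.smul L).isBounded hL

end Packing

/-! ### Upper bound -/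

theorem exists_isCompact_measure_le_mul {α : Type*} [TopologicalSpace α] [MeasurableSpace α]
    {μ : Measure α} [μ.InnerRegularCompactLTTop] {E : Set α} (hE : MeasurableSet E)
    (hEt : μ E ≠ ⊤) {c : ℝ≥0∞} (hc : 1 < c) : ∃ K ⊆ E, IsCompact K ∧ μ E ≤ c * μ K := by
  rcases eq_or_ne (μ E) 0 with h0 | h0
  · exact ⟨∅, Set.empty_subset _, isCompact_empty, by simp [h0]⟩
  have hlt : μ E / c < μ E := ENNReal.div_lt_of_lt_mul' (by
    simpa using ENNReal.mul_lt_mul_left h0 hEt hc)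
  obtain ⟨K, hKE, hK, hK'⟩ := hE.exists_lt_isCompact_of_ne_top hEt hlt
  rw [ENNReal.div_lt_iff (.inl (zero_lt_one.trans hc).ne') (.inr hEt), mul_comm] at hK'
  exact ⟨K, hKE, hK, hK'.le⟩

/-- The energy per unit area of the infinite homogeneous gas at density `ρ`, defined through
Dirichlet energies of squares. -/
noncomputable def gpDensity (G : ℝ) (ρ : ℝ≥0∞) : ℝ≥0∞ :=
  ⨅ ℓ : Set.Ioi (0 : ℝ), dirichletDensity G ρ (openSquare 0 ℓ)

section UpperBound

variable {G : ℝ} {ρ : ℝ≥0∞} {D : Set Plane}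

theorem gpDensity_le_dirichletDensity_smul_openSquare (G : ℝ) (ρ : ℝ≥0∞) {L ℓ : ℝ} (hL : 0 < L)
    (a : Plane) (hℓ : 0 < ℓ) : gpDensity G ρ ≤ dirichletDensity G ρ (L • openSquare a ℓ) := by
  rw [smul_openSquare hL, dirichletDensity_openSquare]
  exact iInf_le (fun r : Set.Ioi (0 : ℝ) => dirichletDensity G ρ (openSquare 0 r))
    ⟨L * ℓ, mul_pos hL hℓ⟩

theorem dirichletDensity_openSquare_ne_top (hG : 0 ≤ G) (hρ : ρ ≠ ⊤) (a : Plane) {ℓ : ℝ}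
    (hℓ : 0 < ℓ) : dirichletDensity G ρ (openSquare a ℓ) ≠ ⊤ := by
  have h0 := volume_openSquare_ne_zero a hℓ
  exact ENNReal.div_ne_top (dirichletEnergy_ne_top hG (isOpen_openSquare a ℓ)
    (nonempty_of_measure_ne_zero h0) (ENNReal.mul_ne_top hρ (volume_openSquare_ne_top a ℓ))) h0

theorem gpDensity_ne_top (hG : 0 ≤ G) (hρ : ρ ≠ ⊤) : gpDensity G ρ ≠ ⊤ :=
  ne_top_of_le_ne_top (dirichletDensity_openSquare_ne_top hG hρ 0 one_pos)
    (iInf_le (fun ℓ : Set.Ioi (0 : ℝ) => dirichletDensity G ρ (openSquare 0 ℓ))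
      ⟨1, Set.mem_Ioi.2 one_pos⟩)

theorem volume_smul_plane (L : ℝ) (S : Set Plane) :
    volume (L • S) = ENNReal.ofReal (L ^ 2) * volume S := by
  rw [Measure.addHaar_smul, finrank_euclideanSpace_fin, abs_of_nonneg (by positivity)]

theorem eventually_dirichletDensity_smul_le (hG : 0 ≤ G) (hD : IsOpen D) (hDt : volume D ≠ ⊤)
    {s : ℝ≥0} (hs : 0 < s) {ℓ : ℝ} (hℓ : 0 < ℓ) :
    ∀ᶠ L : ℝ in atTop, dirichletDensity G ρ (L • D) ≤
      ((1 + s : ℝ≥0) : ℝ≥0∞) ^ 2 * dirichletDensity G ρ (openSquare 0 ℓ) := by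
  have hs1 : 1 < 1 + s := lt_add_of_pos_right 1 hs
  obtain ⟨K, hKD, hK, hKv⟩ := exists_isCompact_measure_le_mul hD.measurableSet hDt
    (c := (1 + s : ℝ≥0)) (by exact_mod_cast hs1)
  filter_upwards [eventually_exists_packing G ρ hℓ hK hD hKD] with L ⟨N, hKN, hND, hN⟩
  have hmass : ρ * volume (L • D) ≤ (1 + s : ℝ≥0) * (ρ * N) := by
    rw [mul_left_comm]
    gcongr
    calc volume (L • D) ≤ (1 + s : ℝ≥0) * volume (L • K) := by
          simp only [volume_smul_plane]
          rw [mul_left_comm]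
          gcongr
      _ ≤ (1 + s : ℝ≥0) * N := by gcongr
  refine ENNReal.div_le_of_le_mul ((dirichletEnergy_le_sq_mul hG hs1.le hmass).trans ?_)
  rw [mul_assoc, mul_comm (dirichletDensity _ _ _)]
  gcongr
  exact hN.trans (by gcongr)

theorem limsup_dirichletDensity_smul_le (hG : 0 ≤ G) (hD : IsOpen D) (hDt : volume D ≠ ⊤) :
    limsup (fun L : ℝ => dirichletDensity G ρ (L • D)) atTop ≤ gpDensity G ρ := by
  refine le_iInf fun ⟨ℓ, hℓ⟩ => ?_
  have hlim : Tendsto (fun s : ℝ≥0 => ((1 + s : ℝ≥0) : ℝ≥0∞) ^ 2 *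
      dirichletDensity G ρ (openSquare 0 ℓ)) (𝓝[>] 0)
        (𝓝 (dirichletDensity G ρ (openSquare 0 ℓ))) := by
    have h : Tendsto (fun s : ℝ≥0 => ((1 + s : ℝ≥0) : ℝ≥0∞) ^ 2) (𝓝[>] 0) (𝓝 1) := by
      have hc : Continuous fun s : ℝ≥0 => ((1 + s : ℝ≥0) : ℝ≥0∞) ^ 2 := by fun_prop
      simpa using (hc.tendsto 0).mono_left nhdsWithin_le_nhds
    simpa using ENNReal.Tendsto.mul_const h (.inl one_ne_zero)
  refine ge_of_tendsto hlim ?_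
  filter_upwards [self_mem_nhdsWithin] with s hs
  exact limsup_le_of_le (h := eventually_dirichletDensity_smul_le hG hD hDt hs hℓ)

end UpperBound

/-! ### Localization of Neumann trial states -/

theorem norm_add_sq_le_mul_add_mul {E : Type*} [SeminormedAddCommGroup E] {δ : ℝ} (hδ : 0 < δ)
    (a b : E) : ‖a + b‖ ^ 2 ≤ (1 + δ) * ‖a‖ ^ 2 + (1 + δ⁻¹) * ‖b‖ ^ 2 := by
  have hsq : 0 ≤ δ⁻¹ * (δ * ‖a‖ - ‖b‖) ^ 2 := by positivity
  calc ‖a + b‖ ^ 2 ≤ (‖a‖ + ‖b‖) ^ 2 := by gcongr; exact norm_add_le a b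
    _ = (1 + δ) * ‖a‖ ^ 2 + (1 + δ⁻¹) * ‖b‖ ^ 2 - δ⁻¹ * (δ * ‖a‖ - ‖b‖) ^ 2 := by
        field_simp
        ring
    _ ≤ _ := sub_le_self _ hsq

theorem partialDeriv_comp_smul {φ : Plane → ℝ} (hφ : Differentiable ℝ φ) (c : ℝ) (j : Fin 2)
    (x : Plane) : partialDeriv j (fun x => φ (c • x)) x = c * partialDeriv j φ (c • x) := by
  have h := (hφ (c • x)).hasFDerivAt.comp x ((hasFDerivAt_id x).const_smul c)
  exact (DFunLike.congr_fun h.fderiv _).trans (by simp [partialDeriv])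

theorem IsTestFunction.comp_inv_smul {U : Set Plane} {φ : Plane → ℝ} (h : IsTestFunction U φ)
    {L : ℝ} (hL : L ≠ 0) : IsTestFunction (L • U) fun x => φ (L⁻¹ • x) := by
  rw [← Set.preimage_smul_inv₀ hL]
  exact h.comp_homeomorph (Homeomorph.smulOfNeZero L⁻¹ (inv_ne_zero hL))
    (contDiff_const_smul (L⁻¹ : ℝ))

theorem IsTestFunction.exists_sum_partialDeriv_sq_le {U : Set Plane} {φ : Plane → ℝ}
    (h : IsTestFunction U φ) : ∃ B, ∀ x, ∑ j, partialDeriv j φ x ^ 2 ≤ B := by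
  choose B hB using fun j =>
    (h.hasCompactSupport_partialDeriv j).exists_bound_of_continuous (h.continuous_partialDeriv j)
  refine ⟨∑ j, B j ^ 2, fun x => Finset.sum_le_sum fun j _ => ?_⟩
  exact sq_le_sq' (neg_le_of_abs_le (hB j x)) (le_of_abs_le (hB j x))

section Localization

variable {G : ℝ} {U C : Set Plane} {u : Plane → ℂ} {g : Fin 2 → Plane → ℂ}

theorem gpIntegrand_cutoff_le (hG : 0 ≤ G) {δ : ℝ} (hδ : 0 < δ) {c : ℝ}
    (hc : c ∈ Set.Icc (0 : ℝ) 1) (d : Fin 2 → ℝ) (x : Plane) (z : ℂ) (w : Fin 2 → ℂ) :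
    gpIntegrand G x (c * z) (fun j => c * w j + d j * z) ≤
      (1 + δ) * gpIntegrand G x z w + (1 + δ⁻¹) / 2 * (∑ j, d j ^ 2) * ‖z‖ ^ 2 := by
  have hc1 : ∀ y : ℂ, ‖c * y‖ ≤ ‖y‖ := fun y => by
    rw [norm_mul, Complex.norm_of_nonneg hc.1]
    exact mul_le_of_le_one_left (norm_nonneg y) hc.2
  have hgrad : ∀ j, ‖-Complex.I * (c * w j + d j * z) - (perp x j : ℂ) * (c * z)‖ ^ 2 ≤
      (1 + δ) * ‖-Complex.I * w j - (perp x j : ℂ) * z‖ ^ 2 +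
        (1 + δ⁻¹) * (d j ^ 2 * ‖z‖ ^ 2) := fun j => by
    calc ‖-Complex.I * (c * w j + d j * z) - (perp x j : ℂ) * (c * z)‖ ^ 2
        = ‖c * (-Complex.I * w j - (perp x j : ℂ) * z) + -Complex.I * (d j * z)‖ ^ 2 := by
          ring_nf
      _ ≤ _ := norm_add_sq_le_mul_add_mul hδ _ _
      _ ≤ (1 + δ) * ‖-Complex.I * w j - (perp x j : ℂ) * z‖ ^ 2 +
            (1 + δ⁻¹) * ‖-Complex.I * (d j * z)‖ ^ 2 := by gcongr; exact hc1 _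
      _ = _ := by simp [mul_pow]
  have hquartic : G * ‖c * z‖ ^ 4 ≤ (1 + δ) * (G * ‖z‖ ^ 4) := by
    calc G * ‖c * z‖ ^ 4 ≤ G * ‖z‖ ^ 4 := by gcongr; exact hc1 z
      _ ≤ _ := le_mul_of_one_le_left (by positivity) (by linarith)
  have hsum := Finset.sum_le_sum fun j (_ : j ∈ Finset.univ) => hgrad j
  rw [Finset.sum_add_distrib, ← Finset.mul_sum, ← Finset.mul_sum, ← Finset.sum_mul] at hsum
  unfold gpIntegrand
  linarith

theorem dirichletEnergy_cutoff_le (hG : 0 ≤ G) (hU : IsOpen U) (hu : MemH1 U u g)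
    {χ : Plane → ℝ} (hχ : IsTestFunction U χ) (hχ01 : ∀ x, χ x ∈ Set.Icc (0 : ℝ) 1)
    {s B : ℝ≥0} (hs : 0 < s)
    (hB : ∀ x, (1 + (s : ℝ)⁻¹) / 2 * ∑ j, partialDeriv j χ x ^ 2 ≤ B) :
    dirichletEnergy G U (mass U fun x => (χ x : ℂ) * u x) ≤
      (1 + s : ℝ≥0) * gpFunctional G U u g + B * mass U u := by
  have hmeas : AEMeasurable (fun x => ENNReal.ofReal (‖u x‖ ^ 2)) (volume.restrict U) :=
    (hu.memLp.1.norm.aemeasurable.pow_const 2).ennreal_ofReal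
  refine (dirichletEnergy_mass_le (hu.cutoff hU hχ)).trans ?_
  rw [gpFunctional_eq_lintegral, gpFunctional_eq_lintegral, mass,
    ← lintegral_const_mul' _ _ ENNReal.coe_ne_top, ← lintegral_const_mul' _ _ ENNReal.coe_ne_top,
    ← lintegral_add_right' _ (hmeas.const_mul _)]
  refine lintegral_mono fun x => ?_
  simp only [← ENNReal.ofReal_coe_nnreal]
  rw [← ENNReal.ofReal_mul (by positivity), ← ENNReal.ofReal_mul (by positivity),
    ← ENNReal.ofReal_add (mul_nonneg (by positivity) (gpIntegrand_nonneg hG x _ _))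
      (by positivity)]
  refine ENNReal.ofReal_le_ofReal ?_
  calc _ ≤ _ := gpIntegrand_cutoff_le hG (NNReal.coe_pos.2 hs) (hχ01 x) _ x (u x) (g · x)
    _ ≤ _ := by
      push_cast
      gcongr
      exact hB x

theorem eventually_exists_dirichletEnergy_le (hG : 0 ≤ G) (hU : IsOpen U) (hC : IsCompact C)
    (hCU : C ⊆ U) {s : ℝ≥0} (hs : 0 < s) :
    ∀ᶠ L : ℝ in atTop, ∀ u g, MemH1 (L • U) u g → ∃ m, mass (L • C) u ≤ m ∧
      dirichletEnergy G (L • U) m ≤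
        (1 + s : ℝ≥0) * gpFunctional G (L • U) u g + s * mass (L • U) u := by
  obtain ⟨χ, hχ, hχ01, hχC⟩ := exists_isTestFunction_eqOn_one hC hU hCU
  obtain ⟨B, hB⟩ := hχ.exists_sum_partialDeriv_sq_le
  have hlim : Tendsto (fun L : ℝ => (1 + (s : ℝ)⁻¹) / 2 * (L⁻¹ ^ 2 * B)) atTop (𝓝 0) := by
    simpa using ((tendsto_inv_atTop_zero.pow 2).mul_const B).const_mul ((1 + (s : ℝ)⁻¹) / 2)
  filter_upwards [eventually_gt_atTop 0, hlim.eventually_le_const (NNReal.coe_pos.2 hs)]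
    with L hL hLs u g hu
  have hcut := hχ.comp_inv_smul hL.ne'
  have hgrad : ∀ x, (1 + (s : ℝ)⁻¹) / 2 *
      ∑ j, partialDeriv j (fun x => χ (L⁻¹ • x)) x ^ 2 ≤ s := fun x => by
    refine le_trans ?_ hLs
    simp only [partialDeriv_comp_smul hχ.differentiable, mul_pow, ← Finset.mul_sum]
    gcongr
    exact hB _
  refine ⟨_, ?_, dirichletEnergy_cutoff_le hG (hU.smul₀ hL.ne') hu hcut (fun x => hχ01 _) hs hgrad⟩
  calc mass (L • C) u = mass (L • C) fun x => (χ (L⁻¹ • x) : ℂ) * u x :=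
        setLIntegral_congr_fun (hC.smul L).measurableSet fun x hx => by
          simp [hχC ((Set.mem_smul_set_iff_inv_smul_mem₀ hL.ne' _ _).1 hx)]
    _ ≤ _ := lintegral_mono_set (Set.smul_set_mono hCU)

theorem norm_sq_le_gpIntegrand (hG : 0 < G) {t : ℝ} (ht : 0 < t) (x : Plane) (z : ℂ)
    (w : Fin 2 → ℂ) : ‖z‖ ^ 2 ≤ 2 * t / G * gpIntegrand G x z w + 1 / (4 * t) := by
  have hsq : 0 ≤ (2 * t * ‖z‖ ^ 2 - 1) ^ 2 / (4 * t) := by positivity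
  have hquartic : t * ‖z‖ ^ 4 ≤ 2 * t / G * gpIntegrand G x z w := by
    calc t * ‖z‖ ^ 4 = 2 * t / G * (1 / 2 * (0 + G * ‖z‖ ^ 4)) := by field_simp; ring
      _ ≤ 2 * t / G * gpIntegrand G x z w := by unfold gpIntegrand; gcongr; positivity
  calc ‖z‖ ^ 2 = t * ‖z‖ ^ 4 + 1 / (4 * t) - (2 * t * ‖z‖ ^ 2 - 1) ^ 2 / (4 * t) := by
        field_simp
        ring
    _ ≤ _ := by linarith

theorem mass_le_mass_add (hG : 0 < G) {t : ℝ} (ht : 0 < t) (U C : Set Plane) (u : Plane → ℂ)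
    (g : Fin 2 → Plane → ℂ) :
    mass U u ≤ mass C u + (ENNReal.ofReal (2 * t / G) * gpFunctional G U u g +
      ENNReal.ofReal (1 / (4 * t)) * volume (U \ C)) := by
  have hdiff : mass (U \ C) u ≤ ENNReal.ofReal (2 * t / G) * gpFunctional G U u g +
      ENNReal.ofReal (1 / (4 * t)) * volume (U \ C) := by
    calc mass (U \ C) u
        ≤ ∫⁻ x in U \ C, (ENNReal.ofReal (2 * t / G) *
            ENNReal.ofReal (gpIntegrand G x (u x) (g · x)) + ENNReal.ofReal (1 / (4 * t))) := by
          refine lintegral_mono fun x => ?_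
          rw [← ENNReal.ofReal_mul (by positivity)]
          exact (ENNReal.ofReal_le_ofReal (norm_sq_le_gpIntegrand hG ht x _ _)).trans
            ENNReal.ofReal_add_le
      _ = ENNReal.ofReal (2 * t / G) * gpFunctional G (U \ C) u g +
            ENNReal.ofReal (1 / (4 * t)) * volume (U \ C) := by
          rw [lintegral_add_right _ measurable_const,
            lintegral_const_mul' _ _ ENNReal.ofReal_ne_top, setLIntegral_const]
          rfl
      _ ≤ _ := by gcongr; exact lintegral_mono_set Set.sdiff_subset
  calc mass U u ≤ mass (C ∪ U \ C) u := lintegral_mono_set (by simp)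
    _ ≤ mass C u + mass (U \ C) u := lintegral_union_le _ _ _
    _ ≤ _ := by gcongr

theorem exists_mass_le_mass_add_mul_volume (hG : 0 < G) (b : ℝ≥0) {η : ℝ≥0} (hη : 0 < η) :
    ∃ r : ℝ≥0, 0 < r ∧ ∀ (U C : Set Plane) u g, gpFunctional G U u g ≤ b * volume U →
      volume (U \ C) ≤ r * volume U → mass U u ≤ mass C u + η * volume U := by
  lift G to ℝ≥0 using hG.le
  have hG' : 0 < G := hG
  set t : ℝ≥0 := η * G / (4 * (b + 1))
  have ht : 0 < t := by positivity
  refine ⟨2 * t * η, by positivity, fun U C u g hF hUC => ?_⟩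
  have hcoef : 2 * t / G * b + 1 / (4 * t) * (2 * t * η) ≤ η := by
    have hb : b / (b + 1) ≤ 1 := div_le_one_of_le₀ (by simp) zero_le
    calc 2 * t / G * b + 1 / (4 * t) * (2 * t * η) = η / 2 * (b / (b + 1)) + η / 2 := by
          simp only [t]
          field_simp
          norm_num
      _ ≤ η / 2 * 1 + η / 2 := by gcongr
      _ = η := by rw [mul_one, add_halves]
  refine (mass_le_mass_add hG (NNReal.coe_pos.2 ht) U C u g).trans (add_le_add_right ?_ _)
  calc _ ≤ ((2 * t / G : ℝ≥0) : ℝ≥0∞) * (b * volume U) +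
        ((1 / (4 * t) : ℝ≥0) : ℝ≥0∞) * ((2 * t * η : ℝ≥0) * volume U) := by
        rw [← ENNReal.ofReal_coe_nnreal, ← ENNReal.ofReal_coe_nnreal (p := 1 / (4 * t))]
        push_cast
        gcongr
        exact_mod_cast hUC
    _ = ((2 * t / G * b + 1 / (4 * t) * (2 * t * η) : ℝ≥0) : ℝ≥0∞) * volume U := by
        push_cast
        ring
    _ ≤ η * volume U := by gcongr

end Localization

/-! ### Lower bound -/

/-- The Neumann energy per unit area of `U` at density `ρ`. -/
noncomputable def neumannDensity (G : ℝ) (ρ : ℝ≥0∞) (U : Set Plane) : ℝ≥0∞ :=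
  neumannEnergy G U (ρ * volume U) / volume U

theorem exists_isCompact_subset_disjoint_isOpen {α : Type*} [TopologicalSpace α] [T2Space α]
    [MeasurableSpace α] [OpensMeasurableSpace α] {μ : Measure α} [μ.InnerRegularCompactLTTop]
    {D W : Set α} (hD : IsOpen D) (hW : IsOpen W) (hDW : D ⊆ W) (hWt : μ W ≠ ⊤)
    {ε c : ℝ≥0∞} (hε : ε ≠ 0) (hc : 1 < c) :
    ∃ C U K V, IsCompact C ∧ IsOpen U ∧ C ⊆ U ∧ U ⊆ D ∧ μ (D \ C) ≤ ε ∧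
      IsCompact K ∧ IsOpen V ∧ K ⊆ V ∧ V ⊆ W ∧ μ (W \ D) ≤ c * μ K ∧
        Disjoint U V ∧ μ V ≤ μ (W \ D) + ε := by
  obtain ⟨C, hCD, hC, hCε⟩ :=
    hD.measurableSet.exists_isCompact_sdiff_lt (measure_ne_top_of_subset hDW hWt) hε
  obtain ⟨K, hKD, hK, hKc⟩ := exists_isCompact_measure_le_mul
    (hW.measurableSet.diff hD.measurableSet) (measure_ne_top_of_subset Set.sdiff_subset hWt) hc
  obtain ⟨U, V, hU, hV, hCU, hKV, hUV⟩ := SeparatedNhds.of_isCompact_isCompact hC hK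
    ((Set.disjoint_sdiff_right.mono_left hCD).mono_right hKD)
  have hVsub : V ∩ W ⊆ W \ D ∪ D \ C := fun x hx => (em (x ∈ D)).elim
    (fun hxD => .inr ⟨hxD, fun hxC => hUV.notMem_of_mem_left (hCU hxC) hx.1⟩)
    fun hxD => .inl ⟨hx.2, hxD⟩
  exact ⟨C, U ∩ D, K, V ∩ W, hC, hU.inter hD, Set.subset_inter hCU hCD, Set.inter_subset_right,
    hCε.le, hK, hV.inter hW, Set.subset_inter hKV (hKD.trans Set.sdiff_subset),
    Set.inter_subset_right, hKc, hUV.mono Set.inter_subset_left Set.inter_subset_left,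
    (measure_mono hVsub).trans ((measure_union_le _ _).trans (by gcongr))⟩

theorem mul_volume_smul_le_mul_add {D W K : Set Plane} {ρ c m N : ℝ≥0∞} {L : ℝ}
    (hD : MeasurableSet D) (hDW : D ⊆ W) (hK : volume (W \ D) ≤ c * volume K)
    (hm : ρ * volume (L • D) ≤ c * m) (hN : volume (L • K) ≤ N) :
    ρ * volume (L • W) ≤ c * (m + ρ * N) := by
  calc ρ * volume (L • W)
      = ρ * volume (L • D) + ρ * volume (L • (W \ D)) := by
        simp only [volume_smul_plane, ← mul_add]
        rw [measure_add_sdiff hD.nullMeasurableSet, Set.union_eq_self_of_subset_left hDW]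
    _ ≤ c * m + ρ * (c * volume (L • K)) := by
        gcongr
        rw [volume_smul_plane, volume_smul_plane, mul_left_comm]
        gcongr
    _ ≤ c * m + ρ * (c * N) := by gcongr
    _ = c * (m + ρ * N) := by ring

section LowerBound

variable {G : ℝ} {D : Set Plane} {ρ b s : ℝ≥0}

theorem exists_gpFunctional_lt_of_neumannDensity_lt {ρ b : ℝ≥0∞} (hD0 : volume D ≠ 0)
    (hDt : volume D ≠ ⊤) (h : neumannDensity G ρ D < b) :
    ∃ u g, MemH1 D u g ∧ mass D u = ρ * volume D ∧ gpFunctional G D u g < b * volume D := by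
  rw [neumannDensity, ENNReal.div_lt_iff (.inl hD0) (.inl hDt)] at h
  obtain ⟨_, ⟨u, g, hu, hM, rfl⟩, hlt⟩ := sInf_lt_iff.1 h
  exact ⟨u, g, hu, hM, hlt⟩

theorem exists_forall_eventually_dirichletEnergy_le (hG : 0 < G) (hρ : 0 < ρ) (hs : 0 < s)
    (b : ℝ≥0) :
    ∃ r : ℝ≥0, 0 < r ∧ ∀ C U D : Set Plane, IsCompact C → IsOpen U → C ⊆ U → U ⊆ D →
      volume D ≠ ⊤ → volume (D \ C) ≤ r * volume D →
      ∀ᶠ L : ℝ in atTop, ∀ u g, MemH1 (L • D) u g → mass (L • D) u = ρ * volume (L • D) →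
        gpFunctional G (L • D) u g ≤ b * volume (L • D) →
        ∃ m, ρ * volume (L • D) ≤ (1 + s : ℝ≥0) * m ∧
          dirichletEnergy G (L • U) m ≤ ((1 + s) * b + s * ρ : ℝ≥0) * volume (L • D) := by
  obtain ⟨r, hr, hmass⟩ := exists_mass_le_mass_add_mul_volume hG b
    (η := s * ρ / (1 + s)) (by positivity)
  refine ⟨r, hr, fun C U D hC hU hCU hUD hDt hDC => ?_⟩
  filter_upwards [eventually_exists_dirichletEnergy_le hG.le hU hC hCU hs, eventually_gt_atTop 0]
    with L hcut hL u g hu huM huF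
  have hUDL : L • U ⊆ L • D := Set.smul_set_mono hUD
  obtain ⟨m, hCm, hm⟩ := hcut u g (hu.mono hUDL)
  refine ⟨m, ?_, hm.trans ?_⟩
  · have hconc : ρ * volume (L • D) ≤ m + (s * ρ / (1 + s) : ℝ≥0) * volume (L • D) := by
      rw [← huM]
      refine (hmass _ (L • C) u g huF ?_).trans (add_le_add_left hCm _)
      rw [← Set.smul_set_sdiff₀ hL.ne', volume_smul_plane, volume_smul_plane, mul_left_comm]
      gcongr
    have hfin : s * ρ * volume (L • D) ≠ ⊤ := by rw [volume_smul_plane]; finiteness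
    refine (ENNReal.add_le_add_iff_right hfin).1 ?_
    calc ρ * volume (L • D) + s * ρ * volume (L • D)
        = (1 + s : ℝ≥0) * (ρ * volume (L • D)) := by push_cast; ring
      _ ≤ (1 + s : ℝ≥0) * (m + (s * ρ / (1 + s) : ℝ≥0) * volume (L • D)) := by gcongr
      _ = (1 + s : ℝ≥0) * m + s * ρ * volume (L • D) := by
        rw [mul_add, ← mul_assoc, ← ENNReal.coe_mul, mul_div_cancel₀ _ (by positivity),
          ENNReal.coe_mul]
  · calc (1 + s : ℝ≥0) * gpFunctional G (L • U) u g + s * mass (L • U) u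
        ≤ (1 + s : ℝ≥0) * gpFunctional G (L • D) u g + s * mass (L • D) u := by
          gcongr <;> exact lintegral_mono_set hUDL
      _ ≤ (1 + s : ℝ≥0) * (b * volume (L • D)) + s * (ρ * volume (L • D)) := by rw [huM]; gcongr
      _ = ((1 + s) * b + s * ρ : ℝ≥0) * volume (L • D) := by push_cast; ring

theorem exists_forall_frequently_dirichletEnergy_le (hG : 0 < G) (hρ : 0 < ρ) (hs : 0 < s)
    (hD0 : volume D ≠ 0) (hDt : volume D ≠ ⊤)
    (hb : ∃ᶠ L : ℝ in atTop, neumannDensity G ρ (L • D) < b) :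
    ∃ r : ℝ≥0, 0 < r ∧ ∀ C U : Set Plane, IsCompact C → IsOpen U → C ⊆ U → U ⊆ D →
      volume (D \ C) ≤ r * volume D → ∃ᶠ L : ℝ in atTop, ∃ m,
        ρ * volume (L • D) ≤ (1 + s : ℝ≥0) * m ∧
          dirichletEnergy G (L • U) m ≤ ((1 + s) * b + s * ρ : ℝ≥0) * volume (L • D) := by
  obtain ⟨r, hr, h⟩ := exists_forall_eventually_dirichletEnergy_le hG hρ hs b
  refine ⟨r, hr, fun C U hC hU hCU hUD hDC => ?_⟩
  refine (hb.and_eventually ((h C U D hC hU hCU hUD hDt hDC).and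
    (eventually_gt_atTop 0))).mono fun L ⟨hbL, hloc, hL⟩ => ?_
  obtain ⟨u, g, hu, huM, huF⟩ := exists_gpFunctional_lt_of_neumannDensity_lt
    (by rw [volume_smul_plane]; positivity) (by rw [volume_smul_plane]; finiteness) hbL
  exact hloc u g hu huM huF.le

theorem volume_mul_gpDensity_smul_le (hG : 0 ≤ G) (hs : 1 ≤ s) {ρ m N : ℝ≥0∞} {U V : Set Plane}
    {a : Plane} {κ L : ℝ} (hκ : 0 < κ) (hL : 0 < L) (hU : MeasurableSet U) (hV : MeasurableSet V)
    (hUV : Disjoint U V) (hUW : U ⊆ L • openSquare a κ) (hVW : V ⊆ L • openSquare a κ)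
    (hN : ρ * volume (L • openSquare a κ) ≤ s * (m + N)) :
    volume (L • openSquare a κ) * gpDensity G ρ ≤
      (s : ℝ≥0∞) ^ 2 * (dirichletEnergy G U m + dirichletEnergy G V N) := by
  have hLκ : 0 < L * κ := mul_pos hL hκ
  calc volume (L • openSquare a κ) * gpDensity G ρ
      ≤ volume (L • openSquare a κ) * dirichletDensity G ρ (L • openSquare a κ) := by
        gcongr
        exact gpDensity_le_dirichletDensity_smul_openSquare G ρ hL a hκ
    _ = dirichletEnergy G (L • openSquare a κ) (ρ * volume (L • openSquare a κ)) := by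
        rw [smul_openSquare hL]
        exact volume_mul_dirichletDensity (volume_openSquare_ne_zero _ hLκ)
          (volume_openSquare_ne_top _ _)
    _ ≤ (s : ℝ≥0∞) ^ 2 * dirichletEnergy G (L • openSquare a κ) (m + N) :=
        dirichletEnergy_le_sq_mul hG hs hN
    _ ≤ _ := by
        gcongr
        exact dirichletEnergy_add_le G hU hV hUV hUW hVW m N

theorem volume_mul_gpDensity_le_of_frequently (hG : 0 < G) (hρ : 0 < ρ) (hD : IsOpen D)
    (hD0 : volume D ≠ 0) {a : Plane} {κ : ℝ} (hκ : 0 < κ) (hDW : D ⊆ openSquare a κ)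
    (hb : ∃ᶠ L : ℝ in atTop, neumannDensity G ρ (L • D) < b) (hs : 0 < s) {ℓ : ℝ} (hℓ : 0 < ℓ) :
    volume (openSquare a κ) * gpDensity G ρ ≤
      ((1 + s : ℝ≥0) : ℝ≥0∞) ^ 2 * (((1 + s) * b + s * ρ : ℝ≥0) * volume D +
        (volume (openSquare a κ \ D) + s * volume D) *
          dirichletDensity G ρ (openSquare 0 ℓ)) := by
  have hWt := volume_openSquare_ne_top a κ
  have hs1 : 1 < 1 + s := lt_add_of_pos_right 1 hs
  obtain ⟨r, hr, hloc⟩ := exists_forall_frequently_dirichletEnergy_le hG hρ hs hD0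
    (measure_ne_top_of_subset hDW hWt) hb
  obtain ⟨C, U, K, V, hC, hU, hCU, hUD, hDC, hK, hV, hKV, hVW, hWDK, hUV, hVvol⟩ :=
    exists_isCompact_subset_disjoint_isOpen (μ := volume) hD (isOpen_openSquare a κ) hDW hWt
      (ε := (min r s : ℝ≥0) * volume D) (c := (1 + s : ℝ≥0))
      (mul_ne_zero (ENNReal.coe_ne_zero.2 (lt_min hr hs).ne') hD0) (by exact_mod_cast hs1)
  obtain ⟨L, ⟨m, hm, hmE⟩, ⟨N, hKN, hNV, hNE⟩, hL⟩ := ((hloc C U hC hU hCU hUD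
    (hDC.trans (by gcongr; exact min_le_left r s))).and_eventually
      ((eventually_exists_packing G ρ hℓ hK hV hKV).and (eventually_gt_atTop 0))).exists
  have hmain := volume_mul_gpDensity_smul_le hG.le hs1.le hκ hL (hU.smul₀ hL.ne').measurableSet
    (hV.smul₀ hL.ne').measurableSet
    ((Set.disjoint_image_iff (smul_right_injective Plane hL.ne')).2 hUV)
    (Set.smul_set_mono (hUD.trans hDW)) (Set.smul_set_mono hVW)
    (mul_volume_smul_le_mul_add hD.measurableSet hDW hWDK hm hKN)
  refine (ENNReal.mul_le_mul_iff_right (a := ENNReal.ofReal (L ^ 2)) (by positivity)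
    ENNReal.ofReal_ne_top).1 ?_
  calc _ = volume (L • openSquare a κ) * gpDensity G ρ := by rw [volume_smul_plane, mul_assoc]
    _ ≤ _ := hmain
    _ ≤ ((1 + s : ℝ≥0) : ℝ≥0∞) ^ 2 * (((1 + s) * b + s * ρ : ℝ≥0) * volume (L • D) +
          volume (L • V) * dirichletDensity G ρ (openSquare 0 ℓ)) := by
        gcongr
        exact hNE.trans (by gcongr)
    _ ≤ ((1 + s : ℝ≥0) : ℝ≥0∞) ^ 2 * (((1 + s) * b + s * ρ : ℝ≥0) *
          (ENNReal.ofReal (L ^ 2) * volume D) + ENNReal.ofReal (L ^ 2) *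
            (volume (openSquare a κ \ D) + s * volume D) *
              dirichletDensity G ρ (openSquare 0 ℓ)) := by
        rw [volume_smul_plane, volume_smul_plane]
        gcongr
        exact hVvol.trans (by gcongr; exact min_le_right r s)
    _ = _ := by ring

theorem volume_mul_gpDensity_le_add (hG : 0 < G) (hρ : 0 < ρ) (hD : IsOpen D)
    (hD0 : volume D ≠ 0) {a : Plane} {κ : ℝ} (hκ : 0 < κ) (hDW : D ⊆ openSquare a κ)
    (hb : ∃ᶠ L : ℝ in atTop, neumannDensity G ρ (L • D) < b) :
    volume (openSquare a κ) * gpDensity G ρ ≤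
      volume D * b + volume (openSquare a κ \ D) * gpDensity G ρ := by
  have hWt := volume_openSquare_ne_top a κ
  have hDt := measure_ne_top_of_subset hDW hWt
  have hWDt : volume (openSquare a κ \ D) ≠ ⊤ := measure_ne_top_of_subset Set.sdiff_subset hWt
  nth_rw 2 [gpDensity]
  rw [ENNReal.mul_iInf fun h => absurd h hWDt, ENNReal.add_iInf]
  refine le_iInf fun ⟨ℓ, hℓ⟩ => ?_
  have hbound := fun s (hs : 0 < s) =>
    volume_mul_gpDensity_le_of_frequently hG hρ hD hD0 hκ hDW hb (s := s) hs hℓ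
  have hδ := dirichletDensity_openSquare_ne_top hG.le (ENNReal.coe_ne_top (r := ρ)) 0 hℓ
  lift dirichletDensity G ρ (openSquare 0 ℓ) to ℝ≥0 using hδ with δ
  lift volume (openSquare a κ \ D) to ℝ≥0 using hWDt with B
  lift volume D to ℝ≥0 using hDt with A
  have hcont : Continuous fun s : ℝ≥0 => ((1 + s : ℝ≥0) : ℝ≥0∞) ^ 2 *
      (((1 + s) * b + s * ρ : ℝ≥0) * A + (B + s * A) * δ) := by
    norm_cast
    fun_prop
  refine ge_of_tendsto (x := 𝓝[>] (0 : ℝ≥0)) ((hcont.tendsto' 0 _ ?_).mono_left nhdsWithin_le_nhds)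
    (eventually_mem_nhdsWithin.mono hbound)
  simp [mul_comm]

theorem gpDensity_le_of_frequently (hG : 0 < G) (hρ : 0 < ρ) (hD : IsOpen D)
    (hDb : Bornology.IsBounded D) (hD' : D.Nonempty)
    (hb : ∃ᶠ L : ℝ in atTop, neumannDensity G ρ (L • D) < b) : gpDensity G ρ ≤ b := by
  have hD0 : volume D ≠ 0 := (hD.measure_pos volume hD').ne'
  obtain ⟨a, κ, hκ, hDW⟩ := exists_subset_openSquare hDb
  have hWt := volume_openSquare_ne_top a κ
  have hWDt : volume (openSquare a κ \ D) ≠ ⊤ := measure_ne_top_of_subset Set.sdiff_subset hWt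
  have h := volume_mul_gpDensity_le_add hG hρ hD hD0 hκ hDW hb
  rw [← measure_sdiff_add_inter (openSquare a κ) hD.measurableSet, Set.inter_eq_right.2 hDW,
    add_comm, add_mul, ENNReal.add_le_add_iff_right
      (ENNReal.mul_ne_top hWDt (gpDensity_ne_top hG.le ENNReal.coe_ne_top))] at h
  exact (ENNReal.mul_le_mul_iff_right hD0 (measure_ne_top_of_subset hDW hWt)).1 h

theorem gpDensity_le_liminf_neumannDensity (hG : 0 < G) (hρ : 0 < ρ) (hD : IsOpen D)
    (hDb : Bornology.IsBounded D) (hD' : D.Nonempty) :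
    gpDensity G ρ ≤ liminf (fun L : ℝ => neumannDensity G ρ (L • D)) atTop := by
  refine le_of_forall_gt_imp_ge_of_dense fun b hb => ?_
  rcases eq_or_ne b ⊤ with rfl | hbt
  · exact le_top
  lift b to ℝ≥0 using hbt
  exact gpDensity_le_of_frequently hG hρ hD hDb hD' (frequently_lt_of_liminf_lt (h := hb))

end LowerBound

theorem theorem2p1_general (G ϱ : ℝ) (hG : 0 < G) (hϱ : 0 < ϱ) :
    ∃ e : ℝ≥0, ∀ D : Set Plane, IsOpen D → Bornology.IsBounded D → D.Nonempty →
        Tendsto (fun L : ℝ =>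
          neumannEnergy G (L • D) (ENNReal.ofReal ϱ * volume (L • D)) / volume (L • D))
          atTop (𝓝 (e : ℝ≥0∞)) ∧
        Tendsto (fun L : ℝ =>
          dirichletEnergy G (L • D) (ENNReal.ofReal ϱ * volume (L • D)) / volume (L • D))
          atTop (𝓝 (e : ℝ≥0∞)) := by
  lift ϱ to ℝ≥0 using hϱ.le
  rw [NNReal.coe_pos] at hϱ
  refine ⟨(gpDensity G ϱ).toNNReal, fun D hD hDb hD' => ?_⟩
  rw [ENNReal.coe_toNNReal (gpDensity_ne_top hG.le ENNReal.coe_ne_top), ENNReal.ofReal_coe_nnreal]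
  have hle (L : ℝ) : neumannDensity G ϱ (L • D) ≤ dirichletDensity G ϱ (L • D) :=
    ENNReal.div_le_div_right (neumannEnergy_le_dirichletEnergy G _ _) _
  have hlower := gpDensity_le_liminf_neumannDensity hG hϱ hD hDb hD'
  have hupper := limsup_dirichletDensity_smul_le (ρ := ϱ) hG.le hD hDb.measure_lt_top.ne
  exact ⟨tendsto_of_le_liminf_of_limsup_le hlower
      ((limsup_le_limsup (.of_forall hle)).trans hupper),
    tendsto_of_le_liminf_of_limsup_le (hlower.trans (liminf_le_liminf (.of_forall hle))) hupper⟩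

theorem theorem2p1 (G ϱ : ℝ) (hG : 0 < G) (hϱ : 0 < ϱ) :
    ∃ e : ℝ≥0, ∀ D : Set Plane, IsOpen D → Bornology.IsBounded D → IsSimplyConnected D →
      HasLipschitzBoundary D →
        Tendsto (fun L : ℝ =>
          neumannEnergy G (L • D) (ENNReal.ofReal ϱ * volume (L • D)) / volume (L • D))
          atTop (𝓝 (e : ℝ≥0∞)) ∧
        Tendsto (fun L : ℝ =>
          dirichletEnergy G (L • D) (ENNReal.ofReal ϱ * volume (L • D)) / volume (L • D))
          atTop (𝓝 (e : ℝ≥0∞)) := by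
  obtain ⟨e, he⟩ := theorem2p1_general G ϱ hG hϱ
  exact ⟨e, fun D hD hDb hDs _ => he D hD hDb hDs.nonempty⟩
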